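/- **Theorem 3 (Upper bound for ICL risk with biased labels).** *Pretraining.* Fix $d,M\in\mathbb N$, weights $0<\pi_m<1$ with $\sum_{m=1}^M\pi_m=1$, centers $\mu_m,w_m\in\mathbb R^d$ with $\|\mu_m\|=\|w_m\|=1$, and $\sigma_x,\sigma_y>0$. For $\sigma_\mu,\sigma_w>0$, a pretraining sequence of length $K$ is generated by drawing a task $(\mu,w)$ from the prior $\sum_{m}\pi_m\,\mathcal N(\mu_m,\sigma_\mu^2I)\otimes\mathcal N(w_m,\sigma_w^2I)$ and then $K$ i.i.d. samples $x_i\sim\mathcal N(\mu,\sigma_x^2I)$, $y_i\mid x_i\sim\mathcal N(\langle w,x_i\rangle,\sigma_y^2)$. Write $\delta_\mu=\sigma_\mu^2/\sigma_x^2$, $\delta_w=\sigma_w^2/\sigma_y^2$, and $S_k\oplus x_{k+1}=[x_1,y_1,\dots,x_k,y_k,x_{k+1}]$. Let $\mathcal F$ be an optimally pretrained (Bayes-optimal) predictor, i.e. a predictor, continuous in $S_k\oplus x_{k+1}$ for each $k$, that for every $K\ge1$ minimizes the pretraining risk $\mathbb E\big[\frac1K\sum_{k=0}^{K-1}(\mathcal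 F(S_k\oplus x_{k+1})-y_{k+1})^2\big]$ among all measurable predictors. *Prompt.* The in-context examples satisfy $x_i\sim\mathcal N(\mu^*,\tau_x^2I)$ i.i.d. and $y_i=\langle x_i,w^*\rangle$, with $\|\mu^*\|=\|w^*\|=1$ and $\tau_x>0$. Let $\alpha\in\{1,\dots,M\}$ with $w^*\ne w_\alpha$, and suppose that for some $d_\mu,d_w,u_w>0$ and all $\beta\neq\alpha$: $\|\mu_\beta-\mu^*\|^2-\|\mu_\alpha-\mu^*\|^2\ge d_\mu^2$, $\|w_\beta-w^*\|^2-\|w_\alpha-w^*\|^2\ge d_w^2$, and $\tau_x^2\|w_\beta-w^*\|^2-(1+\tau_x^2)\|w_\alpha-w^*\|^2\ge\tau_x^2u_w^2$. Let $\mathcal L_k^\alpha=(\mathcal F(S_k\oplus x_{k+1})-\langle x_{k+1},w_\alpha\rangle)^2$. *Conclusion.* There are constants $C_1,C_2,C_3,C_4>0$, depending on $d$, $M$, the $\pi_m,\mu_m,w_m$, $\sigma_x,\sigma_y$, $\tau_x$, $(\mu^*,w^*)$, $\alpha$ and the margins $d_\mu,d_w,u_w$, but not on $\sigma_\mu,\sigma_w$,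 such that: 1. for all $\sigma_\mu,\sigma_w>0$, every such $\mathcal F$ and every $\delta\in(0,\tfrac12)$, as $k\to\infty$, $$\mathbb E[\mathcal L_k^\alpha]<\|w_\alpha-w^*\|^2(1+d\tau_x^2)+\frac{C_1}{k\delta_w}\exp\!\big(C_2k^{\frac\delta2-\frac34}\big)+O(k^{-2});$$ 2. for all $\sigma_\mu,\sigma_w>0$, every such $\mathcal F$ and every integer $k$ in the interval $0\le k\le\min\{\frac1{\delta_\mu}-1,\frac1{\delta_w\tau_x^2}\}$, $$\mathbb E[\mathcal L_k^\alpha]<\|w_\alpha-w^*\|^2(1+d\tau_x^2)\min\{1,4k^2\delta_w^2(1+\tau_x^2)^2\}+C_3\exp\!\Big(-k\Big(\frac{d_\mu^2}{8\sigma_x^2}+\frac{u_w^2\tau_x^2}{8\sigma_y^2}\Big)\Big)+C_4\exp\!\Big(-\frac{k^{1/2}}8\Big);$$ 3. (bounded efficacy) for every $N$, if $\delta_\mu$ and $\delta_w$ are sufficiently small, the interval in 2 contains all integers $0\le k\le N$, and for these $k$ the sum of the two exponentially decaying terms in 2 exceeds the first term; for all $\sigma_w>0$ the first term is non-decreasing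 in $k$ and exceeds the sum of the other two for all sufficiently large $k$. -/

import Mathlib

open MeasureTheory ProbabilityTheory Filter Asymptotics
open scoped ENNReal

noncomputable section

namespace ICL

/-- `ℝ^d` with the Euclidean norm. -/
abbrev Vec (d : ℕ) : Type := EuclideanSpace ℝ (Fin d)

/-- The isotropic normal distribution `N(m, s² I)` on `ℝ^d`. -/
def isoGaussian {d : ℕ} (m : Vec d) (s : ℝ) : Measure (Vec d) :=
  multivariateGaussian m (s ^ 2 • (1 : Matrix (Fin d) (Fin d) ℝ))

/-- The task prior: the Gaussian mixture over tasks `(μ, w)` with weights `p m`, centers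
`(μc m, wc m)` and component laws `N(μc m, σμ² I) ⊗ N(wc m, σw² I)`. -/
def taskPrior {d M : ℕ} (p : Fin M → ℝ) (μc wc : Fin M → Vec d) (σμ σw : ℝ) :
    Measure (Vec d × Vec d) :=
  ∑ m, ENNReal.ofReal (p m) • (isoGaussian (μc m) σμ).prod (isoGaussian (wc m) σw)

/-- The law of one labeled sample `(x, y)` of the task `t = (μ, w)`:
`x ∼ N(μ, σx² I)` and `y ∣ x ∼ N(⟨w, x⟩, σy²)`. -/
def taskLaw {d : ℕ} (σx σy : ℝ) (t : Vec d × Vec d) : Measure (Vec d × ℝ) :=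
  ((isoGaussian t.1 σx).prod (gaussianReal 0 (σy ^ 2).toNNReal)).map
    fun q => (q.1, inner ℝ t.2 q.1 + q.2)

/-- A next-token predictor: `F k S x` is the label predicted for the query `x` after the `k`
labeled samples `S`. -/
abbrev Predictor (d : ℕ) : Type := (k : ℕ) → (Fin k → Vec d × ℝ) → Vec d → ℝ

/-- The pretraining risk `E[(1/K) ∑_{k<K} (F(S_k ⊕ x_{k+1}) - y_{k+1})²]`: a task is drawn from
the prior, then `K` labeled samples are drawn i.i.d. from the task. -/
def pretrainRisk {d : ℕ} (prior : Measure (Vec d × Vec d)) (σx σy : ℝ) (K : ℕ)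
    (F : Predictor d) : ℝ≥0∞ :=
  ∫⁻ t, ∫⁻ S : Fin K → Vec d × ℝ,
      ENNReal.ofReal ((1 / (K : ℝ)) * ∑ k : Fin K,
        (F k (fun i : Fin k => S (Fin.castLE k.isLt.le i)) (S k).1 - (S k).2) ^ 2)
    ∂(Measure.pi fun _ => taskLaw σx σy t) ∂prior

/-- `F` attains the optimal pretraining risk, for every sequence length `K`, among all measurable
predictors. Minimality alone fixes `F` only almost everywhere for the pretraining law, which gives
no mass to noiselessly labeled prompts, so `F` is required to be the continuous version. -/
structure IsOptimalPredictor {d : ℕ} (prior : Measure (Vec d × Vec d)) (σx σy : ℝ)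
    (F : Predictor d) : Prop where
  continuous : ∀ k, Continuous fun q : (Fin k → Vec d × ℝ) × Vec d => F k q.1 q.2
  optimal : ∀ K : ℕ, 0 < K → ∀ G : Predictor d,
    (∀ k, Measurable fun q : (Fin k → Vec d × ℝ) × Vec d => G k q.1 q.2) →
      pretrainRisk prior σx σy K F ≤ pretrainRisk prior σx σy K G

/-- The in-context risk measured against the function `v`: the inputs `x_1, …, x_{k+1}` are i.i.d.
`N(μs, τ² I)`, the prompt labels are `y_i = ⟨x_i, ws⟩`, and the risk is
`E[(F(S_k ⊕ x_{k+1}) - ⟨x_{k+1}, v⟩)²]`. -/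
def iclRisk {d : ℕ} (F : Predictor d) (μs ws : Vec d) (τ : ℝ) (v : Vec d) (k : ℕ) : ℝ≥0∞ :=
  ∫⁻ x : Fin (k + 1) → Vec d,
    ENNReal.ofReal ((F k (fun i => (x i.castSucc, inner ℝ (x i.castSucc) ws)) (x (Fin.last k))
      - inner ℝ (x (Fin.last k)) v) ^ 2)
    ∂(Measure.pi fun _ => isoGaussian μs τ)

/-- The non-decreasing term `‖e‖² (1 + d τ²) min {1, 4 k² δw² (1 + τ²)²}`. -/
def risingTerm {d : ℕ} (e : Vec d) (τ δw : ℝ) (k : ℕ) : ℝ :=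
  ‖e‖ ^ 2 * (1 + d * τ ^ 2) * min 1 (4 * (k : ℝ) ^ 2 * δw ^ 2 * (1 + τ ^ 2) ^ 2)

/-- The two exponentially decaying terms
`C₃ exp (-k (dμ² / (8 σx²) + uw² τ² / (8 σy²))) + C₄ exp (-k^{1/2} / 8)`. -/
def decayingTerms (C₃ C₄ dμ uw σx σy τ : ℝ) (k : ℕ) : ℝ :=
  C₃ * Real.exp (-(k : ℝ) * (dμ ^ 2 / (8 * σx ^ 2) + uw ^ 2 * τ ^ 2 / (8 * σy ^ 2))) +
    C₄ * Real.exp (-(k : ℝ) ^ (1 / 2 : ℝ) / 8)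

end ICL

end

/-! The risk of a predictor at prompt length `k` equals that of the posterior mean plus an integral
of squared distances to it, weighted by a positive density. An optimal predictor therefore agrees
almost everywhere with the posterior mean, and by continuity everywhere, including on the null set
of noiselessly labeled prompts (`IsOptimalPredictor.eq_bayesPredictor`). On such prompts all
integrals are Gaussian, and completing the square gives a closed form
(`IsOptimalPredictor.eq_inner`): the prediction is `⟨ws + ∑ q m • u m, x⟩`, where `u m` solves the
ridge equation `(I + δw ∑ xᵢ xᵢᵀ) u = wc m - ws` and the `q m` are Gibbs weights of an explicit
`energy`.

Short prompts (`exists_iclRisk_le_short`). Outside an exponentially rare event the empirical second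
moments lie between about `k τ²` and `k (1 + τ²)`, and the empirical mean is close to `μs`. The
margin `uw` then makes the regression part of the energy favor `α`, and the margin `dμ` makes the
gap from the inputs linear in `k`, so the posterior concentrates on `α`. Its ridge deviation stays
near `wc α - ws`, with relative error at most `min 1 (2 k δw (1 + τ²))`. On the rare event a
deterministic bound `16 ‖x‖²` is weighed against the probability, which costs a multiple of `exp
(-√k / 8)`; the posterior mass off `α` is absorbed into the same term.

Long prompts (`eventually_iclRisk_lt`). Every `u m` tends to zero, so the posterior weights no
longer matter and the prediction approaches `⟨ws, x⟩`. The limiting risk is at most `(1 + τ²) ‖wc α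
- ws‖²`. The margins and the bias force `d ≥ 2` (`two_le_dim`), hence this is strictly below `(1 + d
τ²) ‖wc α - ws‖²`, and the asymptotic bound holds with zero remainder. The comparison of the two
kinds of terms is elementary. -/

noncomputable section

namespace ICL

/-! ### Moments and exponential integrability of isotropic Gaussians. -/

section GaussianMoments

variable {d : ℕ}

instance isGaussian_isoGaussian (m : Vec d) (s : ℝ) : IsGaussian (isoGaussian m s) := by
  unfold isoGaussian; infer_instance

lemma posSemidef_sq_smul_one (s : ℝ) :
    (s ^ 2 • (1 : Matrix (Fin d) (Fin d) ℝ)).PosSemidef :=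
  Matrix.PosSemidef.one.smul (sq_nonneg s)

lemma memLp_inner_isoGaussian (m a : Vec d) (s : ℝ) :
    MemLp (fun x => inner ℝ a x) 2 (isoGaussian m s) :=
  (IsGaussian.memLp_two_id (μ := isoGaussian m s)).const_inner a

lemma integrable_inner_mul_inner (m a b : Vec d) (s : ℝ) :
    Integrable (fun x => inner ℝ a x * inner ℝ b x) (isoGaussian m s) :=
  (memLp_inner_isoGaussian m a s).integrable_mul (memLp_inner_isoGaussian m b s)

lemma integral_inner_isoGaussian (m a : Vec d) (s : ℝ) :
    ∫ x, inner ℝ a x ∂(isoGaussian m s) = inner ℝ a m := by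
  rw [integral_inner IsGaussian.integrable_fun_id]
  simp [isoGaussian]

lemma integral_inner_mul_inner (m a b : Vec d) (s : ℝ) :
    ∫ x, inner ℝ a x * inner ℝ b x ∂(isoGaussian m s) =
      s ^ 2 * inner ℝ a b + inner ℝ a m * inner ℝ b m := by
  have h := covariance_eq_sub (memLp_inner_isoGaussian m a s) (memLp_inner_isoGaussian m b s)
  rw [← covarianceBilin_apply_eq_cov IsGaussian.memLp_two_id, integral_inner_isoGaussian,
    integral_inner_isoGaussian] at h
  have h' : covarianceBilin (isoGaussian m s) a b = s ^ 2 * inner ℝ a b := by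
    rw [isoGaussian, covarianceBilin_multivariateGaussian (posSemidef_sq_smul_one s)]
    simp [Matrix.smul_mulVec, PiLp.inner_apply, dotProduct, Finset.mul_sum, mul_comm, mul_left_comm]
  rw [h'] at h
  simp only [Pi.mul_apply] at h
  linarith

lemma integrable_norm_pow_isoGaussian (m : Vec d) (s : ℝ) (n : ℕ) :
    Integrable (fun x => ‖x‖ ^ n) (isoGaussian m s) := by
  simpa using (IsGaussian.memLp_id (isoGaussian m s) n (by simp)).integrable_norm_pow'

lemma norm_sq_eq_sum_basisFun (x : Vec d) :
    ‖x‖ ^ 2 = ∑ i, inner ℝ (EuclideanSpace.basisFun (Fin d) ℝ i) x *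
      inner ℝ (EuclideanSpace.basisFun (Fin d) ℝ i) x := by
  rw [← (EuclideanSpace.basisFun (Fin d) ℝ).sum_sq_inner_right x]
  simp [sq]

lemma integral_norm_sq_isoGaussian (m : Vec d) (s : ℝ) :
    ∫ x, ‖x‖ ^ 2 ∂(isoGaussian m s) = ‖m‖ ^ 2 + d * s ^ 2 := by
  simp_rw [norm_sq_eq_sum_basisFun]
  rw [integral_finsetSum _ fun i _ => integrable_inner_mul_inner _ _ _ _]
  simp_rw [integral_inner_mul_inner]
  rw [Finset.sum_add_distrib]
  simp
  ring

/-- By Fernique's theorem `exp (C ‖x‖²)` is integrable for some `C > 0`, which dominates `exp (t f)`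
for small `t`. This supplies the hypothesis of the Chernoff bounds for linear and quadratic
statistics. -/
lemma zero_mem_interior_integrableExpSet {m : Vec d} {s : ℝ} {f : Vec d → ℝ} (hf : Measurable f)
    {A : ℝ} (hA : ∀ x, |f x| ≤ A * (1 + ‖x‖ ^ 2)) :
    0 ∈ interior (integrableExpSet f (isoGaussian m s)) := by
  obtain ⟨C, hC, hint⟩ := IsGaussian.exists_integrable_exp_sq (isoGaussian m s)
  have hA' : 0 < |A| + 1 := by positivity
  have key : ∀ t : ℝ, |t| ≤ C / (|A| + 1) → t ∈ integrableExpSet f (isoGaussian m s) := by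
    intro t ht
    have h2 : Integrable (fun x : Vec d => Real.exp C * Real.exp (C * ‖x‖ ^ 2)) (isoGaussian m s) :=
      hint.const_mul _
    refine h2.mono' (by fun_prop) (ae_of_all _ fun x => ?_)
    rw [Real.norm_eq_abs, Real.abs_exp, ← Real.exp_add]
    apply Real.exp_le_exp.2
    have h0 : t * f x ≤ |t| * |f x| := by rw [← abs_mul]; exact le_abs_self _
    have h3 : |f x| ≤ (|A| + 1) * (1 + ‖x‖ ^ 2) :=
      (hA x).trans (mul_le_mul_of_nonneg_right (by linarith [le_abs_self A]) (by positivity))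
    calc t * f x ≤ |t| * |f x| := h0
      _ ≤ C / (|A| + 1) * ((|A| + 1) * (1 + ‖x‖ ^ 2)) := by gcongr
      _ = C + C * ‖x‖ ^ 2 := by field_simp
  rw [mem_interior_iff_mem_nhds]
  filter_upwards [Metric.closedBall_mem_nhds (0 : ℝ) (div_pos hC hA')] with t ht
  exact key t (by simpa using ht)

end GaussianMoments

/-! ### Lebesgue densities of Gaussians and of product measures. -/

section Densities

variable {d : ℕ}

/-- The density of `N(m, s² I)` with respect to the Lebesgue measure. -/
def isoDensity (m : Vec d) (s : ℝ) (x : Vec d) : ℝ :=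
  (∫ v : Vec d, Real.exp (-(1 / (2 * s ^ 2)) * ‖v‖ ^ 2))⁻¹ *
    Real.exp (-(1 / (2 * s ^ 2)) * ‖x - m‖ ^ 2)

lemma integrable_exp_neg_mul_norm_sq {b : ℝ} (hb : 0 < b) :
    Integrable fun v : Vec d => Real.exp (-b * ‖v‖ ^ 2) := by
  have h := GaussianFourier.integrable_cexp_neg_mul_sq_norm_add (V := Vec d) (b := (b : ℂ))
    (by simpa using hb) 0 0
  have h2 := h.re
  refine h2.congr (ae_of_all _ fun v => ?_)
  simp only [zero_mul, add_zero]
  have : (-(b : ℂ) * (‖v‖ : ℂ) ^ 2) = ((-b * ‖v‖ ^ 2 : ℝ) : ℂ) := by push_cast; ring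
  rw [this, ← Complex.ofReal_exp]
  exact Complex.ofReal_re _

lemma integral_exp_neg_mul_norm_sq_pos {b : ℝ} (hb : 0 < b) :
    0 < ∫ v : Vec d, Real.exp (-b * ‖v‖ ^ 2) :=
  integral_exp_pos (integrable_exp_neg_mul_norm_sq hb)

lemma isoDensity_pos {s : ℝ} (hs : 0 < s) (m x : Vec d) : 0 < isoDensity m s x :=
  mul_pos (inv_pos.2 (integral_exp_neg_mul_norm_sq_pos (by positivity))) (Real.exp_pos _)

@[fun_prop]
lemma continuous_isoDensity (m : Vec d) (s : ℝ) : Continuous (isoDensity m s) := by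
  unfold isoDensity; fun_prop

lemma integrable_isoDensity {s : ℝ} (hs : 0 < s) (m : Vec d) : Integrable (isoDensity m s) :=
  ((integrable_exp_neg_mul_norm_sq (by positivity)).comp_sub_right m).const_mul _

/-- Both sides have the same characteristic function, by the Fourier transform of a Gaussian. The
normalizer is kept as an integral, since it cancels from every posterior quantity. -/
lemma isoGaussian_eq_withDensity (m : Vec d) {s : ℝ} (hs : 0 < s) :
    isoGaussian m s = volume.withDensity fun x => ENNReal.ofReal (isoDensity m s x) := by
  have hfin : IsFiniteMeasure
      (volume.withDensity fun x => ENNReal.ofReal (isoDensity m s x)) :=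
    isFiniteMeasure_withDensity_ofReal (integrable_isoDensity hs m).2
  refine Measure.ext_of_charFun ?_
  ext t
  rw [isoGaussian, charFun_multivariateGaussian (posSemidef_sq_smul_one s), charFun_apply,
    integral_withDensity_eq_integral_toReal_smul (by fun_prop) (by simp)]
  simp_rw [ENNReal.toReal_ofReal (isoDensity_pos hs m _).le]
  rw [← integral_add_right_eq_self _ m]
  set b : ℝ := 1 / (2 * s ^ 2) with hb
  have hbpos : 0 < b := by positivity
  have hbre : 0 < (b : ℂ).re := by simpa using hbpos
  have h1 : ∀ v : Vec d, isoDensity m s (v + m) • Complex.exp (inner ℝ (v + m) t * Complex.I) =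
      (((∫ v : Vec d, Real.exp (-b * ‖v‖ ^ 2))⁻¹ : ℝ) : ℂ) *
        Complex.exp (inner ℝ t m * Complex.I) *
        Complex.exp (-(b : ℂ) * ‖v‖ ^ 2 + Complex.I * inner ℝ t v) := by
    intro v
    rw [isoDensity, ← hb, add_sub_cancel_right, Complex.real_smul, Complex.ofReal_mul, mul_assoc,
      mul_assoc, ← Complex.exp_add, Complex.ofReal_exp, ← Complex.exp_add, inner_add_left,
      real_inner_comm, real_inner_comm t m]
    congr 2
    push_cast
    ring
  simp_rw [h1]
  rw [integral_const_mul, GaussianFourier.integral_cexp_neg_mul_sq_norm_add hbre]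
  have h2 : (((∫ v : Vec d, Real.exp (-b * ‖v‖ ^ 2)) : ℝ) : ℂ) =
      (Real.pi / b : ℂ) ^ (Module.finrank ℝ (Vec d) / 2 : ℂ) := by
    rw [← GaussianFourier.integral_cexp_neg_mul_sq_norm hbre, ← integral_complex_ofReal]
    congr 1; ext v; push_cast; rfl
  have h3 : (((∫ v : Vec d, Real.exp (-b * ‖v‖ ^ 2)) : ℝ) : ℂ) ≠ 0 := by
    exact_mod_cast (integral_exp_neg_mul_norm_sq_pos hbpos).ne'
  rw [← h2, Complex.ofReal_inv]
  have h4 : (t : Fin d → ℝ) ⬝ᵥ (s ^ 2 • (1 : Matrix (Fin d) (Fin d) ℝ)).mulVec t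
      = s ^ 2 * ‖t‖ ^ 2 := by
    rw [Matrix.smul_mulVec, Matrix.one_mulVec, dotProduct_smul, EuclideanSpace.real_norm_sq_eq]
    simp [dotProduct, sq]
  rw [h4, sub_eq_add_neg, Complex.exp_add]
  have h5 : Complex.exp (-(((s ^ 2 * ‖t‖ ^ 2 : ℝ) : ℂ) / 2)) =
      Complex.exp (Complex.I ^ 2 * (‖t‖ : ℂ) ^ 2 / (4 * (b : ℂ))) := by
    have hs' : (s : ℂ) ≠ 0 := by exact_mod_cast hs.ne'
    congr 1
    rw [hb, Complex.I_sq]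
    push_cast
    field_simp
    norm_num
  rw [h5]
  generalize (∫ v : Vec d, Real.exp (-b * ‖v‖ ^ 2)) = Z at h3 ⊢
  field_simp

lemma lintegral_fin_prod_eq_prod {n : ℕ} {Ω : Type*} [MeasurableSpace Ω] (ν : Measure Ω)
    [SigmaFinite ν] (f : Fin n → Ω → ℝ≥0∞) (hf : ∀ i, Measurable (f i)) :
    ∫⁻ x : Fin n → Ω, ∏ i, f i (x i) ∂(Measure.pi fun _ => ν) = ∏ i, ∫⁻ z, f i z ∂ν := by
  induction n with
  | zero => simp
  | succ n ih =>
    have h := (measurePreserving_piFinSuccAbove (fun _ : Fin (n + 1) => ν) 0)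
    rw [← (h.symm).lintegral_comp_emb (MeasurableEquiv.measurableEmbedding _)]
    simp_rw [MeasurableEquiv.piFinSuccAbove_symm_apply, Fin.insertNthEquiv,
      Fin.prod_univ_succ, Fin.insertNth_zero]
    simp only [cast_eq, Fin.cons_zero, Fin.cons_succ,
      Equiv.coe_fn_mk]
    rw [lintegral_prod_mul (f := f 0) (g := fun x : Fin n → Ω => ∏ i, f i.succ (x i))
      (hf 0).aemeasurable (Finset.measurable_prod _ fun i _ =>
        (hf _).comp (measurable_pi_apply i)).aemeasurable,
      ih _ fun i => hf _]

lemma pi_withDensity {n : ℕ} {Ω : Type*} [MeasurableSpace Ω] (ν : Measure Ω)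
    [SigmaFinite ν] (f : Ω → ℝ≥0∞) (hf : Measurable f) [SigmaFinite (ν.withDensity f)] :
    Measure.pi (fun _ : Fin n => ν.withDensity f) =
      (Measure.pi fun _ : Fin n => ν).withDensity fun x => ∏ i, f (x i) := by
  refine Measure.pi_eq fun s hs => ?_
  rw [withDensity_apply _ (MeasurableSet.univ_pi hs),
    ← lintegral_indicator (MeasurableSet.univ_pi hs)]
  have : (Set.univ.pi s).indicator (fun x : Fin n → Ω => ∏ i, f (x i)) =
      fun x => ∏ i, (s i).indicator f (x i) := by
    ext x
    by_cases hx : x ∈ Set.univ.pi s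
    · rw [Set.indicator_of_mem hx]
      exact Finset.prod_congr rfl fun i _ => (Set.indicator_of_mem (hx i trivial) _).symm
    · rw [Set.indicator_of_notMem hx]
      simp only [Set.mem_pi, Set.mem_univ, true_implies, not_forall] at hx
      obtain ⟨i, hi⟩ := hx
      exact (Finset.prod_eq_zero (Finset.mem_univ i) (Set.indicator_of_notMem hi _)).symm
  rw [this, lintegral_fin_prod_eq_prod ν _ fun i => hf.indicator (hs i)]
  exact Finset.prod_congr rfl fun i _ => by
    rw [lintegral_indicator (hs i), withDensity_apply _ (hs i)]

end Densities

/-! ### Chernoff bounds and concentration of empirical moments. -/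

section Concentration

/-- The function `t ↦ exp (-t c) * mgf f ν t` equals `1` at `0` and has negative derivative `∫ f -
c` there, so some `t > 0` gives a value below `1`. That value is `ρ`; it depends on neither `N` nor
`s`. -/
lemma exists_chernoff_rate {Ω : Type*} [MeasurableSpace Ω] {ν : Measure Ω} [IsProbabilityMeasure ν]
    {f : Ω → ℝ} (hf : Measurable f) (h0 : 0 ∈ interior (integrableExpSet f ν)) {c : ℝ}
    (hc : ∫ z, f z ∂ν < c) :
    ∃ ρ : ℝ, 0 < ρ ∧ ρ < 1 ∧ ∀ (N : ℕ) (s : Finset (Fin N)),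
      (Measure.pi fun _ : Fin N => ν).real {x | (s.card : ℝ) * c ≤ ∑ i ∈ s, f (x i)} ≤
        ρ ^ s.card := by
  have hder : HasDerivAt (fun t => Real.exp (-t * c) * mgf f ν t) (∫ z, f z ∂ν - c) 0 := by
    have h1 : HasDerivAt (mgf f ν) (∫ z, f z ∂ν) 0 := by
      simpa using hasDerivAt_mgf h0
    have h2 : HasDerivAt (fun t : ℝ => Real.exp (-t * c)) (-c) 0 := by
      simpa using ((hasDerivAt_id (0 : ℝ)).neg.mul_const c).exp
    refine (h2.mul h1).congr_deriv ?_
    simp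
    ring
  have hev : ∀ᶠ t in nhdsWithin (0 : ℝ) (Set.Ioi 0), Real.exp (-t * c) * mgf f ν t < 1 := by
    have := hder.tendsto_slope_zero_right.eventually_lt_const (sub_neg.2 hc)
    filter_upwards [this, self_mem_nhdsWithin] with t ht htpos
    have htpos : 0 < t := htpos
    simp only [zero_add, smul_eq_mul, neg_zero, zero_mul, Real.exp_zero, mgf_zero, one_mul] at ht
    have := neg_of_mul_neg_right ht (by positivity)
    linarith
  have hint : ∀ᶠ t in nhdsWithin (0 : ℝ) (Set.Ioi 0), t ∈ integrableExpSet f ν :=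
    mem_nhdsWithin_of_mem_nhds (mem_interior_iff_mem_nhds.1 h0)
  obtain ⟨t, ⟨ht1, htint⟩, htpos⟩ := ((hev.and hint).and self_mem_nhdsWithin).exists
  have htpos : 0 < t := htpos
  have htint : Integrable (fun z => Real.exp (t * f z)) ν := htint
  refine ⟨_, mul_pos (Real.exp_pos _) (mgf_pos htint), ht1, fun N s => ?_⟩
  have hmp : ∀ i : Fin N, MeasurePreserving (fun x : Fin N → Ω => x i)
      (Measure.pi fun _ => ν) ν := fun i => measurePreserving_eval _ i
  have hindep : iIndepFun (fun (i : Fin N) (x : Fin N → Ω) => f (x i)) (Measure.pi fun _ => ν) :=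
    iIndepFun_pi (X := fun _ => f) fun _ => hf.aemeasurable
  have hmeas : ∀ i : Fin N, Measurable fun x : Fin N → Ω => f (x i) := fun i =>
    hf.comp (measurable_pi_apply i)
  have hint' := hindep.integrable_exp_mul_sum (t := t) (s := s) hmeas fun i _ =>
    (hmp i).integrable_comp_of_integrable htint
  have h := measure_ge_le_exp_mul_mgf (s.card * c) htpos.le hint'
  rw [hindep.mgf_sum hmeas] at h
  have hmgf : ∀ i : Fin N, mgf (fun x : Fin N → Ω => f (x i)) (Measure.pi fun _ => ν) t =
      mgf f ν t := by
    intro i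
    have := mgf_map (μ := Measure.pi fun _ : Fin N => ν) (Y := fun x : Fin N → Ω => x i) (X := f)
      (t := t) (measurable_pi_apply i).aemeasurable
    rw [(hmp i).map_eq] at this
    exact (this (by fun_prop)).symm
  simp only [hmgf, Finset.prod_const, Finset.sum_apply] at h
  refine h.trans (le_of_eq ?_)
  rw [mul_pow, ← Real.exp_nat_mul]
  congr 2
  ring

lemma exists_chernoff_rate_union {Ω : Type*} [MeasurableSpace Ω] {ν : Measure Ω}
    [IsProbabilityMeasure ν] {J : Type*} [Fintype J] {f : J → Ω → ℝ} (hf : ∀ j, Measurable (f j))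
    (h0 : ∀ j, 0 ∈ interior (integrableExpSet (f j) ν)) {c : J → ℝ}
    (hc : ∀ j, ∫ z, f j z ∂ν < c j) :
    ∃ ρ : ℝ, 0 < ρ ∧ ρ < 1 ∧ ∀ (N : ℕ) (s : Finset (Fin N)),
      (Measure.pi fun _ : Fin N => ν).real
        (⋃ j, {x | (s.card : ℝ) * c j ≤ ∑ i ∈ s, f j (x i)}) ≤ Fintype.card J * ρ ^ s.card := by
  choose ρ hρ0 hρ1 hρ using fun j => exists_chernoff_rate (hf j) (h0 j) (hc j)
  obtain ⟨r, hr0, hr1, hr⟩ : ∃ r : ℝ, 0 < r ∧ r < 1 ∧ ∀ j, ρ j ≤ r := by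
    -- An empty `J` does occur, when no mean control is requested or when `d = 0`; any rate in `(0,
    -- 1)` then works.
    by_cases hJ : Nonempty J
    · obtain ⟨j₀, hj₀⟩ := Finite.exists_max ρ
      exact ⟨ρ j₀, hρ0 _, hρ1 _, hj₀⟩
    · exact ⟨1 / 2, by norm_num, by norm_num, fun j => (hJ ⟨j⟩).elim⟩
  refine ⟨r, hr0, hr1, fun N s => (measureReal_iUnion_fintype_le _).trans ?_⟩
  calc _ ≤ ∑ _j : J, r ^ s.card :=
        Finset.sum_le_sum fun j _ => (hρ j N s).trans (pow_le_pow_left₀ (hρ0 j).le (hr j) _)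
    _ = _ := by simp

variable {d : ℕ}

lemma inner_sq_sum_eq {N : ℕ} (s : Finset (Fin N)) (x : Fin N → Vec d) (v : Vec d) :
    ∑ i ∈ s, inner ℝ (x i) v ^ 2 = ∑ a, ∑ b, v a * v b * ∑ i ∈ s, x i a * x i b := by
  have h : ∀ i, inner ℝ (x i) v ^ 2 = ∑ a, ∑ b, v a * v b * (x i a * x i b) := by
    intro i
    rw [sq, PiLp.inner_apply, Finset.sum_mul_sum]
    simp only [RCLike.inner_apply, conj_trivial]
    exact Finset.sum_congr rfl fun a _ => Finset.sum_congr rfl fun b _ => by ring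
  simp_rw [h, Finset.mul_sum]
  rw [Finset.sum_comm]
  exact Finset.sum_congr rfl fun a _ => Finset.sum_comm

/-- Outside an event of exponentially small probability the empirical second moments of Gaussian
samples are uniformly close to their expectation. -/
lemma exists_second_moment_concentration (m : Vec d) (τ : ℝ) {ε : ℝ} (hε : 0 < ε) :
    ∃ C ρ : ℝ, 0 ≤ C ∧ 0 < ρ ∧ ρ < 1 ∧ ∀ (N : ℕ) (s : Finset (Fin N)),
      ∃ B : Set (Fin N → Vec d), MeasurableSet B ∧
        (Measure.pi fun _ : Fin N => isoGaussian m τ).real B ≤ C * ρ ^ s.card ∧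
        ∀ x ∉ B, ∀ v : Vec d,
          |∑ i ∈ s, inner ℝ (x i) v ^ 2 - s.card * (τ ^ 2 * ‖v‖ ^ 2 + inner ℝ m v ^ 2)| ≤
            s.card * ε * ‖v‖ ^ 2 := by
  -- An error `η` in each of the `d²` matrix entries costs at most `d² η ≤ ε` in the quadratic form;
  -- the `+ 1` covers `d = 0`.
  let η : ℝ := ε / (d ^ 2 + 1)
  have hη : 0 < η := by positivity
  let S : Fin d → Fin d → ℝ := fun a b => τ ^ 2 * (if a = b then 1 else 0) + m a * m b
  -- The Boolean index is a sign: one-sided tail bounds for both signs give the two-sided estimate.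
  let f : (Fin d × Fin d) × Bool → Vec d → ℝ := fun j x =>
    (if j.2 then 1 else -1) * (x j.1.1 * x j.1.2)
  let c : (Fin d × Fin d) × Bool → ℝ := fun j => (if j.2 then 1 else -1) * S j.1.1 j.1.2 + η
  have hcoord : ∀ (a : Fin d) (x : Vec d),
      inner ℝ (EuclideanSpace.basisFun (Fin d) ℝ a) x = x a := by
    intro a x; simp [EuclideanSpace.inner_single_left]
  have hint : ∀ a b, ∫ x : Vec d, x a * x b ∂(isoGaussian m τ) = S a b := by
    intro a b
    have := integral_inner_mul_inner m (EuclideanSpace.basisFun (Fin d) ℝ a)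
      (EuclideanSpace.basisFun (Fin d) ℝ b) τ
    simp only [hcoord] at this
    rw [this]
    simp [S, PiLp.single_apply]
  have hmeas : ∀ j, Measurable (f j) := fun j => by simp only [f]; fun_prop
  have hexp : ∀ j, 0 ∈ interior (integrableExpSet (f j) (isoGaussian m τ)) := by
    intro j
    refine zero_mem_interior_integrableExpSet (hmeas j) (A := 1) fun x => ?_
    have h1 : |f j x| = |x j.1.1| * |x j.1.2| := by
      simp only [f]; rw [abs_mul, abs_mul]; split_ifs <;> simp
    have h2 : |x j.1.1| ≤ ‖x‖ := PiLp.norm_apply_le x j.1.1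
    have h3 : |x j.1.2| ≤ ‖x‖ := PiLp.norm_apply_le x j.1.2
    rw [h1]
    nlinarith [mul_le_mul h2 h3 (abs_nonneg _) (norm_nonneg x)]
  have hlt : ∀ j, ∫ x, f j x ∂(isoGaussian m τ) < c j := by
    intro j
    simp only [f, c]
    rw [integral_const_mul, hint]
    linarith
  obtain ⟨ρ, hρ0, hρ1, hρ⟩ := exists_chernoff_rate_union hmeas hexp hlt
  refine ⟨_, ρ, Nat.cast_nonneg _, hρ0, hρ1, fun N s => ⟨_, ?_, hρ N s, fun x hx v => ?_⟩⟩
  · refine MeasurableSet.iUnion fun j => measurableSet_le measurable_const ?_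
    exact Finset.measurable_sum _ fun i _ => (hmeas j).comp (measurable_pi_apply i)
  · simp only [Set.mem_iUnion, Set.mem_ofPred_eq, not_exists, not_le] at hx
    have hab : ∀ a b, |∑ i ∈ s, x i a * x i b - s.card * S a b| ≤ s.card * η := by
      intro a b
      have h1 := hx ((a, b), true)
      have h2 := hx ((a, b), false)
      simp only [f, c, if_true, one_mul, Bool.false_eq_true, if_false, neg_mul,
        Finset.sum_neg_distrib] at h1 h2
      rw [abs_le]
      constructor <;> nlinarith
    have hS : τ ^ 2 * ‖v‖ ^ 2 + inner ℝ m v ^ 2 = ∑ a, ∑ b, v a * v b * S a b := by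
      have h1 := inner_sq_sum_eq (Finset.univ : Finset (Fin 1)) (fun _ => m) v
      simp only [Finset.univ_unique, Finset.sum_const, Finset.card_singleton, one_smul] at h1
      simp only [S, mul_add, Finset.sum_add_distrib]
      rw [← h1, EuclideanSpace.real_norm_sq_eq, Finset.mul_sum]
      congr 1
      refine Finset.sum_congr rfl fun a _ => ?_
      simp
      ring
    rw [inner_sq_sum_eq, hS, Finset.mul_sum, ← Finset.sum_sub_distrib]
    have hv : ∀ a, |v a| ≤ ‖v‖ := fun a => PiLp.norm_apply_le v a
    calc |∑ a, (∑ b, v a * v b * ∑ i ∈ s, x i a * x i b - s.card * ∑ b, v a * v b * S a b)|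
        ≤ ∑ _a : Fin d, ∑ _b : Fin d, ‖v‖ * ‖v‖ * (s.card * η) := by
          refine (Finset.abs_sum_le_sum_abs _ _).trans (Finset.sum_le_sum fun a _ => ?_)
          rw [Finset.mul_sum, ← Finset.sum_sub_distrib]
          refine (Finset.abs_sum_le_sum_abs _ _).trans (Finset.sum_le_sum fun b _ => ?_)
          have : v a * v b * ∑ i ∈ s, x i a * x i b - s.card * (v a * v b * S a b) =
              v a * v b * (∑ i ∈ s, x i a * x i b - s.card * S a b) := by ring
          rw [this, abs_mul, abs_mul]
          gcongr
          · exact hv a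
          · exact hv b
          · exact hab a b
      _ = s.card * (d ^ 2 * η) * ‖v‖ ^ 2 := by
          simp only [Finset.sum_const, Finset.card_univ, Fintype.card_fin, nsmul_eq_mul]; ring
      _ ≤ s.card * ε * ‖v‖ ^ 2 := by
          gcongr
          simp only [η]
          rw [mul_div_assoc', div_le_iff₀ (by positivity)]
          nlinarith

/-- Outside an event of exponentially small probability the empirical means of finitely many
centered linear functionals of Gaussian samples are small. -/
lemma exists_mean_concentration {J : Type*} [Fintype J] (m : Vec d) (τ : ℝ) (a : J → Vec d)
    {η : ℝ} (hη : 0 < η) :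
    ∃ C ρ : ℝ, 0 ≤ C ∧ 0 < ρ ∧ ρ < 1 ∧ ∀ N : ℕ,
      ∃ B : Set (Fin N → Vec d), MeasurableSet B ∧
        (Measure.pi fun _ : Fin N => isoGaussian m τ).real B ≤ C * ρ ^ N ∧
        ∀ x ∉ B, ∀ j, inner ℝ (a j) (∑ i, (x i - m)) ≤ N * η := by
  let f : J → Vec d → ℝ := fun j x => inner ℝ (a j) (x - m)
  have hmeas : ∀ j, Measurable (f j) := fun j => by simp only [f]; fun_prop
  have hexp : ∀ j, 0 ∈ interior (integrableExpSet (f j) (isoGaussian m τ)) := by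
    intro j
    refine zero_mem_interior_integrableExpSet (hmeas j) (A := ‖a j‖ * (1 + ‖m‖)) fun x => ?_
    have h1 : |f j x| ≤ ‖a j‖ * ‖x - m‖ := abs_real_inner_le_norm _ _
    rw [mul_assoc]
    refine h1.trans (mul_le_mul_of_nonneg_left ?_ (norm_nonneg _))
    have := norm_sub_le x m
    nlinarith [norm_nonneg m, norm_nonneg x, sq_nonneg (‖x‖ - 1), sq_nonneg ‖x‖,
      mul_nonneg (norm_nonneg m) (sq_nonneg ‖x‖)]
  have hlt : ∀ j, ∫ x, f j x ∂(isoGaussian m τ) < η := by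
    intro j
    have : ∫ x, f j x ∂(isoGaussian m τ) = 0 := by
      simp only [f, inner_sub_right]
      rw [integral_sub ((memLp_inner_isoGaussian m (a j) τ).integrable one_le_two)
        (integrable_const _), integral_inner_isoGaussian]
      simp
    rwa [this]
  obtain ⟨ρ, hρ0, hρ1, hρ⟩ := exists_chernoff_rate_union hmeas hexp (c := fun _ => η) hlt
  refine ⟨_, ρ, Nat.cast_nonneg _, hρ0, hρ1,
    fun N => ⟨_, ?_, by simpa using hρ N Finset.univ, fun x hx j => ?_⟩⟩
  · refine MeasurableSet.iUnion fun j => measurableSet_le measurable_const ?_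
    exact Finset.measurable_sum _ fun i _ => (hmeas j).comp (measurable_pi_apply i)
  · simp only [Set.mem_iUnion, Set.mem_ofPred_eq, not_exists, not_le] at hx
    have := hx j
    rw [inner_sum]
    exact this.le

end Concentration

/-! ### Densities of samples and the likelihood of a prompt. -/

section Likelihood

variable {d : ℕ}

/-- The density of `taskLaw σx σy t` with respect to the Lebesgue measure. -/
def sampleDensity (σx σy : ℝ) (t : Vec d × Vec d) (z : Vec d × ℝ) : ℝ :=
  isoDensity t.1 σx z.1 * gaussianPDFReal (inner ℝ t.2 z.1) (σy ^ 2).toNNReal z.2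

@[fun_prop]
lemma _root_.Continuous.isoDensity {X : Type*} [TopologicalSpace X] {f g : X → Vec d}
    (hf : Continuous f) (hg : Continuous g) (s : ℝ) :
    Continuous fun a => isoDensity (f a) s (g a) := by
  unfold ICL.isoDensity; fun_prop

@[fun_prop]
lemma _root_.Continuous.sampleDensity {X : Type*} [TopologicalSpace X] {f : X → Vec d × Vec d}
    {g : X → Vec d × ℝ} (hf : Continuous f) (hg : Continuous g) (σx σy : ℝ) :
    Continuous fun a => sampleDensity σx σy (f a) (g a) := by
  unfold ICL.sampleDensity gaussianPDFReal; fun_prop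

lemma isoDensity_le {s : ℝ} (hs : 0 < s) (m x : Vec d) :
    isoDensity m s x ≤ isoDensity (0 : Vec d) s 0 := by
  unfold isoDensity
  refine mul_le_mul_of_nonneg_left (Real.exp_le_exp.2 ?_)
    (inv_nonneg.2 (integral_exp_neg_mul_norm_sq_pos (by positivity)).le)
  have : 0 ≤ 1 / (2 * s ^ 2) * ‖x - m‖ ^ 2 := by positivity
  simpa using this

lemma sampleDensity_pos {σx σy : ℝ} (hσx : 0 < σx) (hσy : 0 < σy) (t : Vec d × Vec d)
    (z : Vec d × ℝ) : 0 < sampleDensity σx σy t z :=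
  mul_pos (isoDensity_pos hσx _ _) (gaussianPDFReal_pos _ _ _ (by simp [hσy.ne']))

lemma sampleDensity_le {σx σy : ℝ} (hσx : 0 < σx) (t : Vec d × Vec d) (z : Vec d × ℝ) :
    sampleDensity σx σy t z ≤ sampleDensity σx σy (0 : Vec d × Vec d) 0 := by
  unfold sampleDensity
  refine mul_le_mul (isoDensity_le hσx _ _) ?_ (gaussianPDFReal_nonneg _ _ _)
    (isoDensity_pos hσx _ _).le
  unfold gaussianPDFReal
  refine mul_le_mul_of_nonneg_left (Real.exp_le_exp.2 ?_) (by positivity)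
  simp only [Prod.snd_zero, Prod.fst_zero, inner_zero_left, sub_zero]
  rw [neg_div, neg_div]
  simp only [ne_eq, OfNat.ofNat_ne_zero, not_false_eq_true, zero_pow, zero_div, neg_zero]
  rw [neg_nonpos]
  positivity

lemma lintegral_taskLaw (σx σy : ℝ) (t : Vec d × Vec d) {f : Vec d × ℝ → ℝ≥0∞}
    (hf : Measurable f) :
    ∫⁻ z, f z ∂(taskLaw σx σy t) =
      ∫⁻ x, ∫⁻ y, f (x, inner ℝ t.2 x + y) ∂(gaussianReal 0 (σy ^ 2).toNNReal)
        ∂(isoGaussian t.1 σx) := by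
  have hm : Measurable fun q : Vec d × ℝ => (q.1, inner ℝ t.2 q.1 + q.2) := by fun_prop
  rw [taskLaw, lintegral_map hf hm, lintegral_prod]
  exact (hf.comp hm).aemeasurable

instance isProbabilityMeasure_taskLaw (σx σy : ℝ) (t : Vec d × Vec d) :
    IsProbabilityMeasure (taskLaw σx σy t) :=
  Measure.isProbabilityMeasure_map (by fun_prop)

lemma taskLaw_eq_withDensity {σx σy : ℝ} (hσx : 0 < σx) (hσy : 0 < σy) (t : Vec d × Vec d) :
    taskLaw σx σy t = volume.withDensity fun z => ENNReal.ofReal (sampleDensity σx σy t z) := by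
  have hcont : Continuous fun z => sampleDensity σx σy t z :=
    by fun_prop
  have hm : Measurable fun z => ENNReal.ofReal (sampleDensity σx σy t z) :=
    hcont.measurable.ennreal_ofReal
  refine Measure.ext_of_lintegral _ fun f hf => ?_
  rw [lintegral_taskLaw _ _ _ hf, lintegral_withDensity_eq_lintegral_mul _ hm hf,
    Measure.volume_eq_prod, lintegral_prod _ (hm.mul hf).aemeasurable,
    isoGaussian_eq_withDensity _ hσx, lintegral_withDensity_eq_lintegral_mul₀ (by fun_prop)]
  · refine lintegral_congr fun x => ?_
    have h1 : ∫⁻ y, f (x, inner ℝ t.2 x + y) ∂(gaussianReal 0 (σy ^ 2).toNNReal) =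
        ∫⁻ y, f (x, y) ∂(gaussianReal (inner ℝ t.2 x) (σy ^ 2).toNNReal) := by
      have h2 := gaussianReal_map_const_add (μ := 0) (v := (σy ^ 2).toNNReal) (inner ℝ t.2 x)
      rw [zero_add] at h2
      rw [← h2, lintegral_map (by fun_prop) (by fun_prop)]
    rw [Pi.mul_apply, h1, gaussianReal_of_var_ne_zero _ (by simp [hσy.ne']),
      lintegral_withDensity_eq_lintegral_mul _ (measurable_gaussianPDF _ _) (by fun_prop),
      ← lintegral_const_mul _ (by fun_prop)]
    refine lintegral_congr fun y => ?_
    simp only [Pi.mul_apply, sampleDensity, gaussianPDF]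
    rw [ENNReal.ofReal_mul (isoDensity_pos hσx _ _).le, mul_assoc]
  · refine AEMeasurable.lintegral_prod_right'
      (f := fun p : Vec d × ℝ => f (p.1, inner ℝ t.2 p.1 + p.2)) ?_
    exact (hf.comp (by fun_prop)).aemeasurable

lemma lintegral_pi_taskLaw {σx σy : ℝ} (hσx : 0 < σx) (hσy : 0 < σy) (t : Vec d × Vec d) {n : ℕ}
    {g : (Fin n → Vec d × ℝ) → ℝ≥0∞} (hg : Measurable g) :
    ∫⁻ S, g S ∂(Measure.pi fun _ : Fin n => taskLaw σx σy t) =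
      ∫⁻ S, ENNReal.ofReal (∏ i, sampleDensity σx σy t (S i)) * g S := by
  have hcont : Continuous fun z => sampleDensity σx σy t z :=
    by fun_prop
  have hm : Measurable fun z => ENNReal.ofReal (sampleDensity σx σy t z) :=
    hcont.measurable.ennreal_ofReal
  have hsf : SigmaFinite
      (volume.withDensity fun z => ENNReal.ofReal (sampleDensity σx σy t z)) := by
    rw [← taskLaw_eq_withDensity hσx hσy]; infer_instance
  rw [taskLaw_eq_withDensity hσx hσy, pi_withDensity _ _ hm,
    lintegral_withDensity_eq_lintegral_mul _ (by fun_prop) hg]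
  simp_rw [ENNReal.ofReal_prod_of_nonneg fun i _ => (sampleDensity_pos hσx hσy t _).le]
  rfl

/-- Passing to the jointly continuous density replaces the varying measure by Lebesgue measure,
where Tonelli's theorem gives measurability. -/
lemma measurable_lintegral_pi_taskLaw {σx σy : ℝ} (hσx : 0 < σx) (hσy : 0 < σy) {n : ℕ}
    {g : (Fin n → Vec d × ℝ) → ℝ≥0∞} (hg : Measurable g) :
    Measurable fun t : Vec d × Vec d =>
      ∫⁻ S, g S ∂(Measure.pi fun _ : Fin n => taskLaw σx σy t) := by
  simp_rw [lintegral_pi_taskLaw hσx hσy _ hg]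
  refine Measurable.lintegral_prod_right' (f := fun p : (Vec d × Vec d) × (Fin n → Vec d × ℝ) =>
    ENNReal.ofReal (∏ i, sampleDensity σx σy p.1 (p.2 i)) * g p.2) ?_
  refine Measurable.mul (Measurable.ennreal_ofReal ?_) (hg.comp measurable_snd)
  exact Finset.measurable_prod _ fun i _ => Continuous.measurable (by fun_prop)

lemma integral_sub_sq_gaussianReal_zero (σ a : ℝ) :
    ∫⁻ y, ENNReal.ofReal ((a - y) ^ 2) ∂(gaussianReal 0 (σ ^ 2).toNNReal) =
      ENNReal.ofReal (a ^ 2 + σ ^ 2) := by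
  have hid : MemLp (fun y : ℝ => y) 2 (gaussianReal 0 (σ ^ 2).toNNReal) :=
    IsGaussian.memLp_two_id
  have h1 : Integrable (fun y : ℝ => y) (gaussianReal 0 (σ ^ 2).toNNReal) :=
    hid.integrable one_le_two
  have h2 : Integrable (fun y : ℝ => y ^ 2) (gaussianReal 0 (σ ^ 2).toNNReal) := hid.integrable_sq
  have hsq : ∫ y : ℝ, y ^ 2 ∂(gaussianReal 0 (σ ^ 2).toNNReal) = σ ^ 2 := by
    have := variance_eq_sub hid
    rw [variance_fun_id_gaussianReal, integral_id_gaussianReal] at this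
    simp only [Pi.pow_apply] at this
    rw [Real.coe_toNNReal _ (sq_nonneg σ)] at this
    linarith
  have hexp : ∀ y : ℝ, (a - y) ^ 2 = a ^ 2 + (-(2 * a)) * y + y ^ 2 := fun y => by ring
  simp_rw [hexp]
  rw [← ofReal_integral_eq_lintegral_ofReal]
  · have h3 : Integrable (fun y : ℝ => a ^ 2 + -(2 * a) * y) (gaussianReal 0 (σ ^ 2).toNNReal) :=
      (integrable_const _).add (h1.const_mul _)
    rw [integral_add h3 h2, integral_add (integrable_const _) (h1.const_mul _), integral_const_mul,
      integral_id_gaussianReal, hsq]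
    simp
  · exact ((integrable_const _).add (h1.const_mul _)).add h2
  · exact ae_of_all _ fun y => by simp only [Pi.zero_apply]; rw [← hexp]; positivity

/-- The density of `(S, x)` for a prompt `S` of labeled samples and a query `x` of the task `t`. -/
def likelihood (σx σy : ℝ) (t : Vec d × Vec d) {k : ℕ} (q : (Fin k → Vec d × ℝ) × Vec d) : ℝ :=
  (∏ i, sampleDensity σx σy t (q.1 i)) * isoDensity t.1 σx q.2

lemma likelihood_pos {σx σy : ℝ} (hσx : 0 < σx) (hσy : 0 < σy) (t : Vec d × Vec d) {k : ℕ}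
    (q : (Fin k → Vec d × ℝ) × Vec d) : 0 < likelihood σx σy t q :=
  mul_pos (Finset.prod_pos fun _ _ => sampleDensity_pos hσx hσy _ _) (isoDensity_pos hσx _ _)

/-- This bound, uniform in task and prompt, is what dominates all posterior integrals and makes them
continuous in the prompt. -/
lemma likelihood_le {σx σy : ℝ} (hσx : 0 < σx) (hσy : 0 < σy) (t : Vec d × Vec d) {k : ℕ}
    (q : (Fin k → Vec d × ℝ) × Vec d) :
    likelihood σx σy t q ≤ likelihood σx σy 0 (0 : (Fin k → Vec d × ℝ) × Vec d) :=
  mul_le_mul (Finset.prod_le_prod (fun _ _ => (sampleDensity_pos hσx hσy _ _).le)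
      fun _ _ => sampleDensity_le hσx _ _) (isoDensity_le hσx _ _) (isoDensity_pos hσx _ _).le
    (Finset.prod_nonneg fun _ _ => (sampleDensity_pos hσx hσy _ _).le)

@[fun_prop]
lemma _root_.Continuous.likelihood {X : Type*} [TopologicalSpace X] {f : X → Vec d × Vec d} {k : ℕ}
    {g : X → (Fin k → Vec d × ℝ) × Vec d} (hf : Continuous f) (hg : Continuous g) (σx σy : ℝ) :
    Continuous fun a => likelihood σx σy (f a) (g a) := by
  unfold ICL.likelihood; fun_prop

end Likelihood

/-! ### The risk at a single prompt length. -/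

section StageRisk

variable {d : ℕ}

/-- The risk of predicting the label of the sample that follows `k` labeled samples. -/
def stageRisk (prior : Measure (Vec d × Vec d)) (σx σy : ℝ) {k : ℕ}
    (f : (Fin k → Vec d × ℝ) × Vec d → ℝ) : ℝ≥0∞ :=
  ∫⁻ t, ∫⁻ S : Fin (k + 1) → Vec d × ℝ,
      ENNReal.ofReal ((f (fun i => S i.castSucc, (S (Fin.last k)).1) - (S (Fin.last k)).2) ^ 2)
    ∂(Measure.pi fun _ => taskLaw σx σy t) ∂prior

lemma lintegral_pi_last {Ω : Type*} [MeasurableSpace Ω] (ν : Measure Ω) [SigmaFinite ν] {k : ℕ}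
    {f : (Fin k → Ω) × Ω → ℝ≥0∞} (hf : Measurable f) :
    ∫⁻ S : Fin (k + 1) → Ω, f (fun i => S i.castSucc, S (Fin.last k)) ∂(Measure.pi fun _ => ν) =
      ∫⁻ S : Fin k → Ω, ∫⁻ z, f (S, z) ∂ν ∂(Measure.pi fun _ => ν) := by
  have h := measurePreserving_piFinSuccAbove (fun _ : Fin (k + 1) => ν) (Fin.last k)
  have hm : Measurable fun p : Ω × (Fin k → Ω) => f (p.2, p.1) := hf.comp measurable_swap
  have h2 := h.lintegral_comp hm
  rw [lintegral_prod_symm _ hm.aemeasurable] at h2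
  rw [← h2]
  refine lintegral_congr fun S => ?_
  simp [MeasurableEquiv.piFinSuccAbove]
  rfl

instance sFinite_volume_prompt (k : ℕ) :
    SFinite (volume : Measure ((Fin k → Vec d × ℝ) × Vec d)) := by
  have h : SigmaFinite (volume : Measure (Vec d × ℝ)) := by
    rw [Measure.volume_eq_prod]; infer_instance
  have h' : SigmaFinite (volume : Measure (Fin k → Vec d × ℝ)) := by
    rw [volume_pi]; exact Measure.pi.sigmaFinite _
  rw [Measure.volume_eq_prod]; infer_instance

/-- Integrating out the label of the query leaves the squared distance to its conditional mean plus
the variance `σy²`. Tonelli then puts the prompt outside, so the minimization becomes pointwise in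
the prompt. -/
lemma stageRisk_eq {prior : Measure (Vec d × Vec d)} [SFinite prior] {σx σy : ℝ} (hσx : 0 < σx)
    (hσy : 0 < σy) {k : ℕ} {f : (Fin k → Vec d × ℝ) × Vec d → ℝ} (hf : Measurable f) :
    stageRisk prior σx σy f =
      ∫⁻ q, ∫⁻ t, ENNReal.ofReal
        (likelihood σx σy t q * ((f q - inner ℝ t.2 q.2) ^ 2 + σy ^ 2)) ∂prior := by
  have hmeas : Measurable fun p : (Vec d × Vec d) × ((Fin k → Vec d × ℝ) × Vec d) =>
      ENNReal.ofReal (likelihood σx σy p.1 p.2 *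
        ((f p.2 - inner ℝ p.1.2 p.2.2) ^ 2 + σy ^ 2)) := by
    refine Measurable.ennreal_ofReal (Measurable.mul ?_ (by fun_prop))
    exact Continuous.measurable (by fun_prop)
  rw [lintegral_lintegral_swap (f := fun (q : (Fin k → Vec d × ℝ) × Vec d) t =>
      ENNReal.ofReal (likelihood σx σy t q * ((f q - inner ℝ t.2 q.2) ^ 2 + σy ^ 2)))
    (hmeas.comp measurable_swap).aemeasurable, stageRisk]
  refine lintegral_congr fun t => ?_
  have hm1 : Measurable fun p : (Fin k → Vec d × ℝ) × (Vec d × ℝ) =>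
      ENNReal.ofReal ((f (p.1, p.2.1) - p.2.2) ^ 2) := by fun_prop
  rw [lintegral_pi_last _ hm1]
  have h1 : ∀ S : Fin k → Vec d × ℝ,
      ∫⁻ z, ENNReal.ofReal ((f (S, z.1) - z.2) ^ 2) ∂(taskLaw σx σy t) =
        ∫⁻ x, ENNReal.ofReal (isoDensity t.1 σx x * ((f (S, x) - inner ℝ t.2 x) ^ 2 + σy ^ 2)) := by
    intro S
    rw [lintegral_taskLaw _ _ _ (by fun_prop)]
    simp_rw [← sub_sub, integral_sub_sq_gaussianReal_zero]
    rw [isoGaussian_eq_withDensity _ hσx,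
      lintegral_withDensity_eq_lintegral_mul _ (by fun_prop) (by fun_prop)]
    refine lintegral_congr fun x => ?_
    rw [Pi.mul_apply, ENNReal.ofReal_mul (isoDensity_pos hσx _ _).le]
  simp_rw [h1]
  rw [lintegral_pi_taskLaw hσx hσy, Measure.volume_eq_prod, lintegral_prod]
  · refine lintegral_congr fun S => ?_
    rw [← lintegral_const_mul _ (by fun_prop)]
    refine lintegral_congr fun x => ?_
    rw [likelihood, mul_assoc, ENNReal.ofReal_mul
      (Finset.prod_nonneg fun _ _ => (sampleDensity_pos hσx hσy _ _).le)]
  · exact (hmeas.comp (measurable_const.prodMk measurable_id)).aemeasurable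
  · refine Measurable.lintegral_prod_right' (f := fun p : (Fin k → Vec d × ℝ) × Vec d =>
      ENNReal.ofReal (isoDensity t.1 σx p.2 * ((f p - inner ℝ t.2 p.2) ^ 2 + σy ^ 2))) ?_
    fun_prop

end StageRisk

/-! ### The posterior mean and the decomposition of the risk. -/

section BayesPredictor

variable {d : ℕ}

/-- The marginal density of a prompt and a query under the prior. -/
def evidence (prior : Measure (Vec d × Vec d)) (σx σy : ℝ) {k : ℕ}
    (q : (Fin k → Vec d × ℝ) × Vec d) : ℝ :=
  ∫ t, likelihood σx σy t q ∂prior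

/-- The integral of the regression vector against the unnormalized posterior. -/
def weightedTask (prior : Measure (Vec d × Vec d)) (σx σy : ℝ) {k : ℕ}
    (q : (Fin k → Vec d × ℝ) × Vec d) : Vec d :=
  ∫ t, likelihood σx σy t q • t.2 ∂prior

/-- The posterior mean of the label of the query. -/
def bayesPredictor (prior : Measure (Vec d × Vec d)) (σx σy : ℝ) {k : ℕ}
    (q : (Fin k → Vec d × ℝ) × Vec d) : ℝ :=
  inner ℝ (weightedTask prior σx σy q) q.2 / evidence prior σx σy q

variable {prior : Measure (Vec d × Vec d)} {σx σy : ℝ}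

lemma integrable_likelihood [IsFiniteMeasure prior] (hσx : 0 < σx) (hσy : 0 < σy) {k : ℕ}
    (q : (Fin k → Vec d × ℝ) × Vec d) :
    Integrable (fun t => likelihood σx σy t q) prior := by
  refine Integrable.mono' (integrable_const (likelihood σx σy 0 (0 : (Fin k → Vec d × ℝ) × Vec d)))
    (Continuous.aestronglyMeasurable (by fun_prop)) (ae_of_all _ fun t => ?_)
  rw [Real.norm_of_nonneg (likelihood_pos hσx hσy t q).le]
  exact likelihood_le hσx hσy t q

lemma integrable_likelihood_mul (hσx : 0 < σx) (hσy : 0 < σy) {k : ℕ}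
    (q : (Fin k → Vec d × ℝ) × Vec d) {h : Vec d × Vec d → ℝ} (hh : Integrable h prior) :
    Integrable (fun t => likelihood σx σy t q * h t) prior := by
  refine hh.bdd_mul (c := likelihood σx σy 0 (0 : (Fin k → Vec d × ℝ) × Vec d))
    (Continuous.aestronglyMeasurable (by fun_prop)) (ae_of_all _ fun t => ?_)
  rw [Real.norm_of_nonneg (likelihood_pos hσx hσy t q).le]
  exact likelihood_le hσx hσy t q

lemma integrable_likelihood_smul (hσx : 0 < σx) (hσy : 0 < σy) {k : ℕ}
    (q : (Fin k → Vec d × ℝ) × Vec d) (hw : Integrable (fun t => t.2) prior) :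
    Integrable (fun t => likelihood σx σy t q • t.2) prior := by
  have hc : Continuous fun t : Vec d × Vec d => likelihood σx σy t q := by fun_prop
  refine hw.bdd_smul (likelihood σx σy 0 (0 : (Fin k → Vec d × ℝ) × Vec d))
    hc.aestronglyMeasurable (ae_of_all _ fun t => ?_)
  rw [Real.norm_of_nonneg (likelihood_pos hσx hσy t q).le]
  exact likelihood_le hσx hσy t q

lemma evidence_pos [IsProbabilityMeasure prior] (hσx : 0 < σx) (hσy : 0 < σy) {k : ℕ}
    (q : (Fin k → Vec d × ℝ) × Vec d) : 0 < evidence prior σx σy q := by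
  rw [evidence, integral_pos_iff_support_of_nonneg (fun t => (likelihood_pos hσx hσy t q).le)
    (integrable_likelihood hσx hσy q)]
  have : Function.support (fun t => likelihood σx σy t q) = Set.univ := by
    ext t; simp [(likelihood_pos hσx hσy t q).ne']
  simp [this]

lemma continuous_evidence [IsFiniteMeasure prior] (hσx : 0 < σx) (hσy : 0 < σy) (k : ℕ) :
    Continuous fun q : (Fin k → Vec d × ℝ) × Vec d => evidence prior σx σy q := by
  refine continuous_of_dominated
    (bound := fun _ => likelihood σx σy 0 (0 : (Fin k → Vec d × ℝ) × Vec d))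
    (fun q => Continuous.aestronglyMeasurable (by fun_prop)) (fun q => ae_of_all _ fun t => ?_)
    (integrable_const _) (ae_of_all _ fun t => by fun_prop)
  rw [Real.norm_of_nonneg (likelihood_pos hσx hσy t q).le]
  exact likelihood_le hσx hσy t q

lemma continuous_weightedTask (hσx : 0 < σx) (hσy : 0 < σy) (k : ℕ)
    (hw : Integrable (fun t => t.2) prior) :
    Continuous fun q : (Fin k → Vec d × ℝ) × Vec d => weightedTask prior σx σy q := by
  refine continuous_of_dominated
    (bound := fun t => likelihood σx σy 0 (0 : (Fin k → Vec d × ℝ) × Vec d) * ‖t.2‖)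
    (fun q => Continuous.aestronglyMeasurable (by fun_prop)) (fun q => ae_of_all _ fun t => ?_)
    (hw.norm.const_mul _) (ae_of_all _ fun t => by fun_prop)
  rw [norm_smul, Real.norm_of_nonneg (likelihood_pos hσx hσy t q).le]
  exact mul_le_mul_of_nonneg_right (likelihood_le hσx hσy t q) (norm_nonneg _)

lemma continuous_bayesPredictor [IsProbabilityMeasure prior] (hσx : 0 < σx) (hσy : 0 < σy) (k : ℕ)
    (hw : Integrable (fun t => t.2) prior) :
    Continuous fun q : (Fin k → Vec d × ℝ) × Vec d => bayesPredictor prior σx σy q :=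
  ((continuous_weightedTask hσx hσy k hw).inner continuous_snd).div
    (continuous_evidence hσx hσy k) fun q => ne_of_gt (evidence_pos hσx hσy q)

/-- The risk of a predictor splits into its weighted distance to the posterior mean and the risk of
the posterior mean. -/
lemma stageRisk_eq_add [IsProbabilityMeasure prior] (hσx : 0 < σx) (hσy : 0 < σy) {k : ℕ}
    (hw : Integrable (fun t => t.2) prior) (hw2 : Integrable (fun t => ‖t.2‖ ^ 2) prior)
    {f : (Fin k → Vec d × ℝ) × Vec d → ℝ} (hf : Measurable f) :
    stageRisk prior σx σy f =
      (∫⁻ q, ENNReal.ofReal (evidence prior σx σy q * (f q - bayesPredictor prior σx σy q) ^ 2)) +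
        stageRisk prior σx σy (bayesPredictor prior σx σy (k := k)) := by
  have hB := (continuous_bayesPredictor (prior := prior) hσx hσy k hw).measurable
  have hE := (continuous_evidence (prior := prior) hσx hσy k).measurable
  -- At a fixed prompt the risk is a quadratic polynomial in the predicted value `a`, with leading
  -- coefficient the evidence and vertex the posterior mean.
  have hpoint : ∀ (q : (Fin k → Vec d × ℝ) × Vec d) (a : ℝ),
      ∫⁻ t, ENNReal.ofReal (likelihood σx σy t q * ((a - inner ℝ t.2 q.2) ^ 2 + σy ^ 2)) ∂prior =
        ENNReal.ofReal (∫ t, likelihood σx σy t q * ((a - inner ℝ t.2 q.2) ^ 2 + σy ^ 2) ∂prior) ∧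
      ∫ t, likelihood σx σy t q * ((a - inner ℝ t.2 q.2) ^ 2 + σy ^ 2) ∂prior =
        evidence prior σx σy q * (a ^ 2 + σy ^ 2) -
          2 * a * inner ℝ (weightedTask prior σx σy q) q.2 +
          ∫ t, likelihood σx σy t q * inner ℝ t.2 q.2 ^ 2 ∂prior := by
    intro q a
    have hi1 := integrable_likelihood (prior := prior) hσx hσy q
    have hin : Integrable (fun t => inner ℝ t.2 q.2) prior := hw.inner_const q.2
    have hi2 := integrable_likelihood_mul hσx hσy q hin
    have hin2 : Integrable (fun t => inner ℝ t.2 q.2 ^ 2) prior := by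
      refine (hw2.mul_const (‖q.2‖ ^ 2)).mono' (hin.aestronglyMeasurable.pow 2)
        (ae_of_all _ fun t => ?_)
      rw [Real.norm_eq_abs, abs_pow, ← mul_pow]
      exact pow_le_pow_left₀ (abs_nonneg _) (abs_real_inner_le_norm _ _) 2
    have hi3 := integrable_likelihood_mul hσx hσy q hin2
    have hexp : ∀ t : Vec d × Vec d,
        likelihood σx σy t q * ((a - inner ℝ t.2 q.2) ^ 2 + σy ^ 2) =
          (likelihood σx σy t q * (a ^ 2 + σy ^ 2) -
            2 * a * (likelihood σx σy t q * inner ℝ t.2 q.2)) +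
            likelihood σx σy t q * inner ℝ t.2 q.2 ^ 2 := fun t => by ring
    have hi4 : Integrable (fun t => likelihood σx σy t q * (a ^ 2 + σy ^ 2) -
        2 * a * (likelihood σx σy t q * inner ℝ t.2 q.2)) prior :=
      (hi1.mul_const _).sub (hi2.const_mul _)
    constructor
    · rw [← ofReal_integral_eq_lintegral_ofReal]
      · simp_rw [hexp]
        exact hi4.add hi3
      · exact ae_of_all _ fun t => mul_nonneg (likelihood_pos hσx hσy t q).le (by positivity)
    · simp_rw [hexp]
      rw [integral_add hi4 hi3, integral_sub (hi1.mul_const _) (hi2.const_mul _),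
        integral_mul_const, integral_const_mul]
      have : inner ℝ (weightedTask prior σx σy q) q.2 =
          ∫ t, likelihood σx σy t q * inner ℝ t.2 q.2 ∂prior := by
        rw [weightedTask, real_inner_comm,
          ← integral_inner (integrable_likelihood_smul hσx hσy q hw)]
        simp_rw [inner_smul_right, real_inner_comm]
      rw [this, evidence]
  rw [stageRisk_eq hσx hσy hf, stageRisk_eq hσx hσy hB, ← lintegral_add_left (by fun_prop)]
  refine lintegral_congr fun q => ?_
  have hDpos := evidence_pos (prior := prior) hσx hσy q
  rw [(hpoint q _).1, (hpoint q _).1, ← ENNReal.ofReal_add (by positivity)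
    (integral_nonneg fun t => mul_nonneg (likelihood_pos hσx hσy t q).le (by positivity)),
    (hpoint q _).2, (hpoint q _).2]
  congr 1
  have hB' : inner ℝ (weightedTask prior σx σy q) q.2 =
      evidence prior σx σy q * bayesPredictor prior σx σy q := by
    rw [bayesPredictor]; field_simp
  rw [hB']
  ring

end BayesPredictor

/-! ### Optimal predictors coincide with the posterior mean. -/

section Optimality

variable {d : ℕ} {prior : Measure (Vec d × Vec d)} {σx σy : ℝ}

/-- With sequence length `k + 1`, only the last summand involves the component `F k`, so that
component can be varied alone. -/
lemma pretrainRisk_succ (hσx : 0 < σx) (hσy : 0 < σy) (k : ℕ) {F : Predictor d}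
    (hF : ∀ k, Measurable fun q : (Fin k → Vec d × ℝ) × Vec d => F k q.1 q.2) :
    pretrainRisk prior σx σy (k + 1) F =
      (∫⁻ t, ∫⁻ S : Fin (k + 1) → Vec d × ℝ,
        ENNReal.ofReal ((1 / ((k + 1 : ℕ) : ℝ)) * ∑ j : Fin k,
          (F j (fun i : Fin j => S (Fin.castLE j.castSucc.isLt.le i)) (S j.castSucc).1 -
            (S j.castSucc).2) ^ 2)
      ∂(Measure.pi fun _ => taskLaw σx σy t) ∂prior) +
      ENNReal.ofReal (1 / ((k + 1 : ℕ) : ℝ)) *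
        stageRisk prior σx σy (fun q : (Fin k → Vec d × ℝ) × Vec d => F k q.1 q.2) := by
  have hlast : Measurable fun S : Fin (k + 1) → Vec d × ℝ =>
      ENNReal.ofReal ((F k (fun i => S i.castSucc) (S (Fin.last k)).1 - (S (Fin.last k)).2) ^ 2) := by
    have h1 : Measurable fun S : Fin (k + 1) → Vec d × ℝ =>
        ((fun i : Fin k => S i.castSucc), (S (Fin.last k)).1) := by fun_prop
    have h2 := (hF k).comp h1
    simp only [Function.comp_def] at h2
    fun_prop
  rw [stageRisk, ← lintegral_const_mul _ (measurable_lintegral_pi_taskLaw hσx hσy hlast),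
    ← lintegral_add_right _ ((measurable_lintegral_pi_taskLaw hσx hσy hlast).const_mul _),
    pretrainRisk]
  refine lintegral_congr fun t => ?_
  rw [← lintegral_const_mul _ hlast, ← lintegral_add_right _ (hlast.const_mul _)]
  refine lintegral_congr fun S => ?_
  rw [Fin.sum_univ_castSucc, mul_add, ENNReal.ofReal_add (by positivity) (by positivity)]
  congr 1
  rw [← ENNReal.ofReal_mul (by positivity)]
  rfl

lemma lintegral_label_sq_le (t : Vec d × Vec d) :
    ∫⁻ z, ENNReal.ofReal (z.2 ^ 2) ∂(taskLaw σx σy t) ≤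
      ENNReal.ofReal (‖t.2‖ ^ 2 * (‖t.1‖ ^ 2 + d * σx ^ 2) + σy ^ 2) := by
  rw [lintegral_taskLaw _ _ _ (by fun_prop)]
  have h : ∀ x : Vec d, ∫⁻ y, ENNReal.ofReal ((inner ℝ t.2 x + y) ^ 2)
      ∂(gaussianReal 0 (σy ^ 2).toNNReal) ≤ ENNReal.ofReal (‖t.2‖ ^ 2 * ‖x‖ ^ 2 + σy ^ 2) := by
    intro x
    have : ∀ y : ℝ, (inner ℝ t.2 x + y) ^ 2 = (-inner ℝ t.2 x - y) ^ 2 := fun y => by ring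
    simp_rw [this]
    rw [integral_sub_sq_gaussianReal_zero]
    refine ENNReal.ofReal_le_ofReal ?_
    rw [neg_sq, ← mul_pow, ← sq_abs]
    gcongr
    exact abs_real_inner_le_norm _ _
  refine (lintegral_mono h).trans (le_of_eq ?_)
  have hi := integrable_norm_pow_isoGaussian t.1 σx 2
  have hi' : Integrable (fun x : Vec d => ‖t.2‖ ^ 2 * ‖x‖ ^ 2 + σy ^ 2) (isoGaussian t.1 σx) :=
    (hi.const_mul _).add (integrable_const _)
  rw [← ofReal_integral_eq_lintegral_ofReal hi'
    (ae_of_all _ fun x => by positivity), integral_add (hi.const_mul _) (integrable_const _),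
    integral_const_mul, integral_norm_sq_isoGaussian]
  simp

/-- The optimal risk is thereby finite, which allows cancellation in `ℝ≥0∞`. -/
lemma pretrainRisk_zero_lt_top [IsProbabilityMeasure prior]
    (hint : Integrable (fun t => ‖t.2‖ ^ 2 * (‖t.1‖ ^ 2 + d * σx ^ 2) + σy ^ 2) prior) (K : ℕ) :
    pretrainRisk prior σx σy K (fun _ _ _ => 0) < ∞ := by
  have h : ∀ t : Vec d × Vec d, ∫⁻ S : Fin K → Vec d × ℝ,
      ENNReal.ofReal ((1 / (K : ℝ)) * ∑ k : Fin K, (0 - (S k).2) ^ 2)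
      ∂(Measure.pi fun _ => taskLaw σx σy t) ≤ ENNReal.ofReal (1 / (K : ℝ)) * (K *
        ENNReal.ofReal (‖t.2‖ ^ 2 * (‖t.1‖ ^ 2 + d * σx ^ 2) + σy ^ 2)) := by
    intro t
    simp_rw [ENNReal.ofReal_mul (show 0 ≤ 1 / (K : ℝ) by positivity)]
    rw [lintegral_const_mul _ (by fun_prop)]
    gcongr
    simp_rw [ENNReal.ofReal_sum_of_nonneg fun i _ => sq_nonneg _]
    rw [lintegral_finsetSum _ fun i _ => by fun_prop]
    calc _ ≤ ∑ _i : Fin K, ENNReal.ofReal (‖t.2‖ ^ 2 * (‖t.1‖ ^ 2 + d * σx ^ 2) + σy ^ 2) := by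
          refine Finset.sum_le_sum fun i _ => ?_
          have := (measurePreserving_eval (fun _ : Fin K => taskLaw σx σy t) i).lintegral_comp
            (f := fun z => ENNReal.ofReal (z.2 ^ 2)) (by fun_prop)
          simp only [zero_sub, neg_sq]
          simp only [Function.eval] at this
          rw [this]
          exact lintegral_label_sq_le t
      _ = _ := by simp
  refine (lintegral_mono h).trans_lt ?_
  rw [lintegral_const_mul' _ _ (by simp), lintegral_const_mul' _ _ (by simp)]
  exact ENNReal.mul_lt_top (by simp) (ENNReal.mul_lt_top (by simp) hint.lintegral_lt_top)

/-- `F` is compared with the predictor that differs from it only at length `k`; the shorter lengths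
contribute equal finite amounts, which cancel. -/
lemma IsOptimalPredictor.stageRisk_le [IsProbabilityMeasure prior] (hσx : 0 < σx) (hσy : 0 < σy)
    (hint : Integrable (fun t => ‖t.2‖ ^ 2 * (‖t.1‖ ^ 2 + d * σx ^ 2) + σy ^ 2) prior)
    {F : Predictor d} (hF : IsOptimalPredictor prior σx σy F) {k : ℕ}
    {g : (Fin k → Vec d × ℝ) × Vec d → ℝ} (hg : Measurable g) :
    stageRisk prior σx σy (fun q : (Fin k → Vec d × ℝ) × Vec d => F k q.1 q.2) ≤
      stageRisk prior σx σy g := by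
  have hFm : ∀ k, Measurable fun q : (Fin k → Vec d × ℝ) × Vec d => F k q.1 q.2 :=
    fun k => (hF.continuous k).measurable
  let G : Predictor d := Function.update F k fun S x => g (S, x)
  have hGk : G k = fun S x => g (S, x) := Function.update_self _ _ _
  have hGj : ∀ j, j ≠ k → G j = F j := fun j hj => Function.update_of_ne hj _ _
  have hGm : ∀ k, Measurable fun q : (Fin k → Vec d × ℝ) × Vec d => G k q.1 q.2 := by
    intro j
    by_cases hj : j = k
    · subst hj; rw [hGk]; exact hg
    · rw [hGj j hj]; exact hFm j
  have hle := hF.optimal (k + 1) k.succ_pos G hGm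
  have hfin := (hF.optimal (k + 1) k.succ_pos (fun _ _ _ => 0) fun _ => measurable_const).trans_lt
    (pretrainRisk_zero_lt_top hint (k + 1))
  have hsame : ∀ j : Fin k, G j = F j := fun j => hGj j j.isLt.ne
  rw [pretrainRisk_succ hσx hσy k hFm] at hle hfin
  rw [pretrainRisk_succ hσx hσy k hGm, hGk] at hle
  simp_rw [hsame] at hle
  have h1 := (ENNReal.add_le_add_iff_left (ne_top_of_lt (lt_of_le_of_lt le_self_add hfin))).1 hle
  exact (ENNReal.mul_le_mul_iff_right (by simp; positivity) (by simp)).1 h1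

instance isOpenPosMeasure_volume_prompt (k : ℕ) :
    (volume : Measure ((Fin k → Vec d × ℝ) × Vec d)).IsOpenPosMeasure := by
  have h0 : SigmaFinite (volume : Measure (Vec d × ℝ)) := by
    rw [Measure.volume_eq_prod]; infer_instance
  have h : (volume : Measure (Vec d × ℝ)).IsOpenPosMeasure := by
    rw [Measure.volume_eq_prod]; infer_instance
  have h' : (volume : Measure (Fin k → Vec d × ℝ)).IsOpenPosMeasure := by
    rw [volume_pi]; infer_instance
  have h0' : SigmaFinite (volume : Measure (Fin k → Vec d × ℝ)) := by
    rw [volume_pi]; exact Measure.pi.sigmaFinite _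
  rw [Measure.volume_eq_prod]; infer_instance

/-- An optimally pretrained predictor is the posterior mean of the label. -/
theorem IsOptimalPredictor.eq_bayesPredictor [IsProbabilityMeasure prior] (hσx : 0 < σx)
    (hσy : 0 < σy) (hw : Integrable (fun t => t.2) prior)
    (hw2 : Integrable (fun t => ‖t.2‖ ^ 2) prior)
    (hint : Integrable (fun t => ‖t.2‖ ^ 2 * (‖t.1‖ ^ 2 + d * σx ^ 2) + σy ^ 2) prior)
    {F : Predictor d} (hF : IsOptimalPredictor prior σx σy F) {k : ℕ}
    (S : Fin k → Vec d × ℝ) (x : Vec d) :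
    F k S x = bayesPredictor prior σx σy (S, x) := by
  have hB := continuous_bayesPredictor (prior := prior) hσx hσy k hw
  have hE := continuous_evidence (prior := prior) hσx hσy k
  have hFc := hF.continuous k
  have hle := hF.stageRisk_le hσx hσy hint hB.measurable
  have hfin : stageRisk prior σx σy
      (bayesPredictor prior σx σy (k := k)) ≠ ∞ := by
    have h1 := (hF.optimal (k + 1) k.succ_pos (fun _ _ _ => 0)
      fun _ => measurable_const).trans_lt (pretrainRisk_zero_lt_top hint (k + 1))
    rw [pretrainRisk_succ hσx hσy k fun k => (hF.continuous k).measurable] at h1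
    have h2 := lt_of_le_of_lt le_add_self h1
    rw [stageRisk_eq_add hσx hσy hw hw2 hFc.measurable] at h2
    intro h3
    rw [h3] at h2
    simp only [add_top] at h2
    rw [ENNReal.mul_top (by simp; positivity)] at h2
    exact lt_irrefl _ h2
  rw [stageRisk_eq_add hσx hσy hw hw2 hFc.measurable] at hle
  have hzero : ∫⁻ q : (Fin k → Vec d × ℝ) × Vec d, ENNReal.ofReal
      (evidence prior σx σy q * (F k q.1 q.2 - bayesPredictor prior σx σy q) ^ 2) = 0 := by
    by_contra hne
    refine absurd hle (not_le.2 ?_)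
    rw [add_comm]
    exact ENNReal.lt_add_right hfin hne
  rw [lintegral_eq_zero_iff (by fun_prop)] at hzero
  have hae : (fun q : (Fin k → Vec d × ℝ) × Vec d => F k q.1 q.2) =ᵐ[volume]
      fun q => bayesPredictor prior σx σy q := by
    filter_upwards [hzero] with q hq
    have hq' := ENNReal.ofReal_eq_zero.1 hq
    have hpos := evidence_pos (prior := prior) hσx hσy q
    have : (F k q.1 q.2 - bayesPredictor prior σx σy q) ^ 2 ≤ 0 := by
      by_contra! h
      exact absurd hq' (not_le.2 (mul_pos hpos h))
    have := pow_eq_zero_iff (two_ne_zero) |>.1 (le_antisymm this (sq_nonneg _))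
    linarith
  -- Lebesgue measure charges every nonempty open set, so continuous functions that agree almost
  -- everywhere agree on null sets too, in particular at noiseless prompts.
  exact congrFun (Continuous.ae_eq_iff_eq volume hFc hB |>.1 hae) (S, x)

end Optimality

/-! ### Gaussian integrals of quadratic exponents. -/

section CompletingTheSquare

variable {d : ℕ}

lemma integral_isoGaussian {E : Type*} [NormedAddCommGroup E] [NormedSpace ℝ E] (m : Vec d) {s : ℝ}
    (hs : 0 < s) (h : Vec d → E) :
    ∫ x, h x ∂(isoGaussian m s) = ∫ x, isoDensity m s x • h x := by
  rw [isoGaussian_eq_withDensity m hs,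
    integral_withDensity_eq_integral_toReal_smul (by fun_prop) (by simp)]
  simp_rw [ENNReal.toReal_ofReal (isoDensity_pos hs m _).le]

lemma integrable_exp_neg_of_le {Q : Vec d → ℝ} (hQ : Continuous Q) {b : ℝ} (hb : 0 < b)
    (hle : ∀ v, b * ‖v‖ ^ 2 ≤ Q v) : Integrable fun v => Real.exp (-Q v) := by
  refine (integrable_exp_neg_mul_norm_sq (d := d) hb).mono'
    (Continuous.aestronglyMeasurable (by fun_prop)) (ae_of_all _ fun v => ?_)
  rw [Real.norm_eq_abs, Real.abs_exp]
  exact Real.exp_le_exp.2 (by linarith [hle v])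

lemma integrable_exp_neg_smul_of_le {Q : Vec d → ℝ} (hQ : Continuous Q) {b : ℝ} (hb : 0 < b)
    (hle : ∀ v, b * ‖v‖ ^ 2 ≤ Q v) : Integrable fun v => Real.exp (-Q v) • v := by
  refine ((integrable_exp_neg_mul_norm_sq (d := d) (half_pos hb)).const_mul (1 + 2 / b)).mono'
    (Continuous.aestronglyMeasurable (by fun_prop)) (ae_of_all _ fun v => ?_)
  rw [norm_smul, Real.norm_eq_abs, Real.abs_exp]
  -- The factor `‖v‖` is paid for with half of the Gaussian exponent.
  have h1 : ‖v‖ ≤ (1 + 2 / b) * (b / 2 * ‖v‖ ^ 2 + 1) := by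
    have : (1 + 2 / b) * (b / 2 * ‖v‖ ^ 2 + 1) =
        ‖v‖ ^ 2 + 1 + (b / 2 * ‖v‖ ^ 2 + 2 / b) := by field_simp; ring
    rw [this]
    have : 0 ≤ b / 2 * ‖v‖ ^ 2 + 2 / b := by positivity
    nlinarith [sq_nonneg (‖v‖ - 1)]
  have h2 : ‖v‖ ≤ (1 + 2 / b) * Real.exp (b / 2 * ‖v‖ ^ 2) :=
    h1.trans (mul_le_mul_of_nonneg_left (Real.add_one_le_exp _) (by positivity))
  calc Real.exp (-Q v) * ‖v‖
      ≤ Real.exp (-(b * ‖v‖ ^ 2)) * ((1 + 2 / b) * Real.exp (b / 2 * ‖v‖ ^ 2)) := by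
        gcongr
        exact hle v
    _ = (1 + 2 / b) * Real.exp (-(b / 2) * ‖v‖ ^ 2) := by
        rw [mul_left_comm, ← Real.exp_add]
        congr 2
        ring

lemma integral_exp_neg_translate {Q h : Vec d → ℝ} {v₀ : Vec d} {ρ : ℝ}
    (hh : ∀ v, h v = Q (v - v₀) + ρ) :
    ∫ v, Real.exp (-h v) = (∫ v, Real.exp (-Q v)) * Real.exp (-ρ) := by
  rw [← integral_mul_const, ← integral_sub_right_eq_self (fun v => Real.exp (-Q v) * _) v₀]
  simp_rw [hh, neg_add, Real.exp_add]

/-- `Q` is even, so the centered first moment vanishes and only the vertex `v₀` remains, times the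
total mass. This identifies the posterior mean of a component. -/
lemma integral_exp_neg_smul_translate {Q h : Vec d → ℝ} (hQ : Continuous Q)
    (heven : ∀ v, Q (-v) = Q v) {b : ℝ} (hb : 0 < b) (hle : ∀ v, b * ‖v‖ ^ 2 ≤ Q v)
    {v₀ : Vec d} {ρ : ℝ} (hh : ∀ v, h v = Q (v - v₀) + ρ) :
    ∫ v, Real.exp (-h v) • v = ((∫ v, Real.exp (-Q v)) * Real.exp (-ρ)) • v₀ := by
  have hodd : ∫ v, Real.exp (-Q v) • v = 0 := by
    have h1 := integral_neg_eq_self (fun v => Real.exp (-Q v) • v) (volume : Measure (Vec d))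
    simp_rw [heven, smul_neg, integral_neg] at h1
    have h2 : (2 : ℝ) • ∫ v, Real.exp (-Q v) • v = 0 := by
      rw [two_smul]; nth_rw 1 [← h1]; exact neg_add_cancel _
    exact (smul_eq_zero.1 h2).resolve_left two_ne_zero
  rw [← integral_add_right_eq_self _ v₀]
  have h2 : ∀ v : Vec d, Real.exp (-h (v + v₀)) • (v + v₀) =
      Real.exp (-ρ) • (Real.exp (-Q v) • v) + (Real.exp (-Q v) * Real.exp (-ρ)) • v₀ := by
    intro v
    rw [hh, add_sub_cancel_right, neg_add, Real.exp_add, smul_add, smul_smul, mul_comm (Real.exp (-ρ))]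
  simp_rw [h2]
  have h3 : Integrable fun v => Real.exp (-ρ) • (Real.exp (-Q v) • v) :=
    (integrable_exp_neg_smul_of_le hQ hb hle).smul (Real.exp (-ρ))
  rw [integral_add h3 (((integrable_exp_neg_of_le hQ hb hle).mul_const _).smul_const _), integral_smul, hodd,
    smul_zero, zero_add, integral_smul_const, integral_mul_const]

/-- The regularized normal equation has a solution. -/
lemma exists_ridge_solution {n : ℕ} {δ : ℝ} (hδ : 0 ≤ δ) (x : Fin n → Vec d) (e : Vec d) :
    ∃ u : Vec d, u + δ • ∑ i, inner ℝ (x i) u • x i = e := by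
  let A : Vec d →ₗ[ℝ] Vec d :=
    LinearMap.id + δ • ∑ i, (innerₛₗ ℝ (x i)).smulRight (x i)
  have hA : ∀ u, A u = u + δ • ∑ i, inner ℝ (x i) u • x i := by
    intro u; simp [A]
  have hinj : Function.Injective A := by
    rw [← LinearMap.ker_eq_bot, LinearMap.ker_eq_bot']
    intro u hu
    rw [hA] at hu
    have h1 : inner ℝ u (u + δ • ∑ i, inner ℝ (x i) u • x i) = 0 := by rw [hu, inner_zero_right]
    rw [inner_add_right, inner_smul_right, inner_sum] at h1
    simp_rw [inner_smul_right, real_inner_comm (x _) u, real_inner_self_eq_norm_sq] at h1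
    have h2 : 0 ≤ δ * ∑ i, inner ℝ u (x i) * inner ℝ u (x i) :=
      mul_nonneg hδ (Finset.sum_nonneg fun i _ => mul_self_nonneg _)
    have h3 : ‖u‖ ^ 2 = 0 := le_antisymm (by simp_rw [real_inner_comm] at h1 h2; linarith) (sq_nonneg _)
    simpa using h3
  obtain ⟨u, hu⟩ := LinearMap.injective_iff_surjective.1 hinj e
  exact ⟨u, by rw [← hA, hu]⟩

/-- Weak form of the ridge equation. Testing it with `u`, `e` and `e - u` yields the ridge estimates
below. -/
lemma inner_ridge_solution {n : ℕ} {δ : ℝ} {x : Fin n → Vec d} {e u : Vec d}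
    (hu : u + δ • ∑ i, inner ℝ (x i) u • x i = e) (v : Vec d) :
    inner ℝ e v = inner ℝ u v + δ * ∑ i, inner ℝ (x i) u * inner ℝ (x i) v := by
  rw [← hu, inner_add_left, inner_smul_left, sum_inner]
  simp [inner_smul_left]

/-- Completing the square in the posterior of the regression vector. -/
lemma regression_exponent_eq {n : ℕ} {σw σy : ℝ} (hσw : 0 < σw) (hσy : 0 < σy)
    {x : Fin n → Vec d} {ws wm u : Vec d}
    (hu : u + (σw ^ 2 / σy ^ 2) • ∑ i, inner ℝ (x i) u • x i = wm - ws) (w : Vec d) :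
    ‖w - wm‖ ^ 2 / (2 * σw ^ 2) + (∑ i, (inner ℝ (x i) ws - inner ℝ w (x i)) ^ 2) / (2 * σy ^ 2) =
      (‖w - (ws + u)‖ ^ 2 +
        σw ^ 2 / σy ^ 2 * ∑ i, inner ℝ (x i) (w - (ws + u)) ^ 2) / (2 * σw ^ 2) +
      (‖wm - ws‖ ^ 2 - inner ℝ u (wm - ws)) / (2 * σw ^ 2) := by
  set δ := σw ^ 2 / σy ^ 2 with hδ
  set e := wm - ws with he
  set y := w - (ws + u) with hy
  have hw1 : w - wm = y + u - e := by rw [hy, he]; abel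
  have hw2 : ∀ i, inner ℝ (x i) ws - inner ℝ w (x i) = -(inner ℝ (x i) y + inner ℝ (x i) u) := by
    intro i
    rw [hy, inner_sub_right, inner_add_right, real_inner_comm w]
    ring
  have hey := inner_ridge_solution hu y
  have heu := inner_ridge_solution hu u
  simp_rw [hw1, hw2, neg_sq]
  have hsum : ∑ i, (inner ℝ (x i) y + inner ℝ (x i) u) ^ 2 =
      ∑ i, inner ℝ (x i) y ^ 2 + 2 * ∑ i, inner ℝ (x i) u * inner ℝ (x i) y +
        ∑ i, inner ℝ (x i) u * inner ℝ (x i) u := by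
    rw [Finset.mul_sum, ← Finset.sum_add_distrib, ← Finset.sum_add_distrib]
    exact Finset.sum_congr rfl fun i _ => by ring
  have hconv : (1 : ℝ) / (2 * σy ^ 2) = δ / (2 * σw ^ 2) := by rw [hδ]; field_simp
  rw [div_eq_mul_one_div _ (2 * σy ^ 2), hconv, hsum, norm_sub_sq_real (y + u) e,
    norm_add_sq_real, inner_add_left]
  rw [real_inner_self_eq_norm_sq, real_inner_comm] at heu
  rw [real_inner_comm, real_inner_comm y u] at hey
  generalize ∑ i, inner ℝ (x i) u * inner ℝ (x i) u = Suu at *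
  generalize ∑ i, inner ℝ (x i) u * inner ℝ (x i) y = Suy at *
  field_simp
  linarith

/-- Completing the square in the posterior of the input mean. -/
lemma mean_exponent_eq {n : ℕ} {σμ σx : ℝ} (hσμ : 0 < σμ) (hσx : 0 < σx)
    (x : Fin n → Vec d) (μs μm μ : Vec d) :
    ‖μ - μm‖ ^ 2 / (2 * σμ ^ 2) + (∑ i, ‖x i - μ‖ ^ 2) / (2 * σx ^ 2) =
      (1 + n * (σμ ^ 2 / σx ^ 2)) / (2 * σμ ^ 2) *
        ‖μ - (μs + (1 + n * (σμ ^ 2 / σx ^ 2))⁻¹ •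
          ((μm - μs) + (σμ ^ 2 / σx ^ 2) • ∑ i, (x i - μs)))‖ ^ 2 +
      ((n * ‖μm - μs‖ ^ 2 - 2 * inner ℝ (μm - μs) (∑ i, (x i - μs))) /
          (2 * σx ^ 2 * (1 + n * (σμ ^ 2 / σx ^ 2))) +
        ((∑ i, ‖x i - μs‖ ^ 2) / (2 * σx ^ 2) -
          σμ ^ 2 / σx ^ 2 * ‖∑ i, (x i - μs)‖ ^ 2 /
            (2 * σx ^ 2 * (1 + n * (σμ ^ 2 / σx ^ 2))))) := by
  set a := μm - μs with ha
  set v := μ - μs with hv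
  set s := ∑ i, (x i - μs) with hs
  set δ := σμ ^ 2 / σx ^ 2 with hδ
  have hpos : 0 < 1 + n * δ := by positivity
  have h1 : μ - μm = v - a := by rw [hv, ha]; abel
  have h2 : ∀ c : Vec d, μ - (μs + c) = v - c := fun c => by rw [hv]; abel
  have h3 : ∑ i, ‖x i - μ‖ ^ 2 = ∑ i, ‖x i - μs‖ ^ 2 - 2 * inner ℝ s v + n * ‖v‖ ^ 2 := by
    have : ∀ i, ‖x i - μ‖ ^ 2 = ‖x i - μs‖ ^ 2 - 2 * inner ℝ (x i - μs) v + ‖v‖ ^ 2 := by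
      intro i
      rw [show x i - μ = (x i - μs) - v by rw [hv]; abel, norm_sub_sq_real]
    simp_rw [this]
    rw [Finset.sum_add_distrib, Finset.sum_sub_distrib, ← Finset.mul_sum, hs, sum_inner]
    simp
  rw [h1, h2, h3, norm_sub_sq_real v a, norm_sub_sq_real v, norm_smul, inner_smul_right,
    inner_add_right, inner_smul_right, mul_pow, norm_add_sq_real a, norm_smul, inner_smul_right,
    Real.norm_of_nonneg (inv_nonneg.2 hpos.le), Real.norm_of_nonneg (by positivity),
    real_inner_comm s v]
  have hσ : σμ ^ 2 = δ * σx ^ 2 := by rw [hδ]; field_simp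
  have hδ0 : 0 < δ := by positivity
  rw [hσ]
  clear_value δ
  field_simp
  ring

end CompletingTheSquare

/-! ### Integration against the Gaussian mixture prior. -/

section TaskPrior

variable {d M : ℕ} {p : Fin M → ℝ} {μc wc : Fin M → Vec d} {σμ σw : ℝ}

lemma isProbabilityMeasure_taskPrior (hp : ∀ m, 0 < p m) (hsum : ∑ m, p m = 1) :
    IsProbabilityMeasure (taskPrior p μc wc σμ σw) := by
  refine ⟨?_⟩
  simp only [taskPrior, Measure.finsetSum_apply, Measure.smul_apply, measure_univ, smul_eq_mul,
    mul_one]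
  rw [← ENNReal.ofReal_sum_of_nonneg fun m _ => (hp m).le, hsum, ENNReal.ofReal_one]

lemma integrable_taskPrior {E : Type*} [NormedAddCommGroup E] {g : Vec d × Vec d → E}
    (hg : ∀ m, Integrable g ((isoGaussian (μc m) σμ).prod (isoGaussian (wc m) σw))) :
    Integrable g (taskPrior p μc wc σμ σw) :=
  integrable_finsetSum_measure.2 fun m _ => (hg m).smul_measure ENNReal.ofReal_ne_top

lemma integral_taskPrior {E : Type*} [NormedAddCommGroup E] [NormedSpace ℝ E] (hp : ∀ m, 0 < p m)
    {g : Vec d × Vec d → E}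
    (hg : ∀ m, Integrable g ((isoGaussian (μc m) σμ).prod (isoGaussian (wc m) σw))) :
    ∫ t, g t ∂(taskPrior p μc wc σμ σw) =
      ∑ m, p m • ∫ t, g t ∂((isoGaussian (μc m) σμ).prod (isoGaussian (wc m) σw)) := by
  rw [taskPrior, integral_finsetSum_measure fun m _ =>
    (hg m).smul_measure ENNReal.ofReal_ne_top]
  refine Finset.sum_congr rfl fun m _ => ?_
  rw [integral_smul_measure, ENNReal.toReal_ofReal (hp m).le]

lemma integrable_snd_prod_isoGaussian (a b : Vec d) (s r : ℝ) :
    Integrable (fun t => t.2) ((isoGaussian a s).prod (isoGaussian b r)) :=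
  (IsGaussian.integrable_fun_id (μ := isoGaussian b r)).comp_snd _

lemma integrable_moment_taskPrior (c c' : ℝ) :
    Integrable (fun t => ‖t.2‖ ^ 2 * (‖t.1‖ ^ 2 + c) + c') (taskPrior p μc wc σμ σw) := by
  refine integrable_taskPrior fun m => Integrable.add ?_ (integrable_const _)
  have h1 : Integrable (fun x => ‖x‖ ^ 2 + c) (isoGaussian (μc m) σμ) :=
    (integrable_norm_pow_isoGaussian _ _ 2).add (integrable_const _)
  have h2 := h1.mul_prod (integrable_norm_pow_isoGaussian (wc m) σw 2)
  simpa only [mul_comm] using h2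

lemma integrable_snd_sq_taskPrior :
    Integrable (fun t => ‖t.2‖ ^ 2) (taskPrior p μc wc σμ σw) :=
  integrable_taskPrior fun m => (integrable_norm_pow_isoGaussian (wc m) σw 2).comp_snd _

end TaskPrior

/-! ### Closed form of the optimal predictor on noiseless prompts. -/

section ClosedForm

variable {d : ℕ}

/-- Whatever does not involve the center `μm` after completing the square goes into `Z`, which is
common to all components and cancels from the posterior weights. -/
lemma exists_integral_prod_isoDensity {n : ℕ} {σμ σx : ℝ} (hσμ : 0 < σμ) (hσx : 0 < σx)
    (x : Fin n → Vec d) (μs : Vec d) :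
    ∃ Z : ℝ, 0 < Z ∧ ∀ μm : Vec d,
      ∫ μ, ∏ i, isoDensity μ σx (x i) ∂(isoGaussian μm σμ) =
        Z * Real.exp (-((n * ‖μm - μs‖ ^ 2 - 2 * inner ℝ (μm - μs) (∑ i, (x i - μs))) /
          (2 * σx ^ 2 * (1 + n * (σμ ^ 2 / σx ^ 2))))) := by
  set κ : ℝ → ℝ := fun s => (∫ v : Vec d, Real.exp (-(1 / (2 * s ^ 2)) * ‖v‖ ^ 2))⁻¹ with hκ
  have hκpos : ∀ s, 0 < s → 0 < κ s := fun s hs =>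
    inv_pos.2 (integral_exp_neg_mul_norm_sq_pos (by positivity))
  set R : ℝ := (∑ i, ‖x i - μs‖ ^ 2) / (2 * σx ^ 2) -
    σμ ^ 2 / σx ^ 2 * ‖∑ i, (x i - μs)‖ ^ 2 /
      (2 * σx ^ 2 * (1 + n * (σμ ^ 2 / σx ^ 2))) with hR
  set b : ℝ := (1 + n * (σμ ^ 2 / σx ^ 2)) / (2 * σμ ^ 2) with hb
  have hbpos : 0 < b := by positivity
  refine ⟨κ σμ * κ σx ^ n * (∫ v : Vec d, Real.exp (-(b * ‖v‖ ^ 2))) * Real.exp (-R), ?_, ?_⟩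
  · have h1 : 0 < ∫ v : Vec d, Real.exp (-(b * ‖v‖ ^ 2)) := by
      simpa only [neg_mul] using integral_exp_neg_mul_norm_sq_pos (d := d) hbpos
    have := hκpos σμ hσμ
    have := hκpos σx hσx
    positivity
  · intro μm
    have hint : ∀ μ : Vec d, isoDensity μm σμ μ • ∏ i, isoDensity μ σx (x i) =
        κ σμ * κ σx ^ n * Real.exp (-(‖μ - μm‖ ^ 2 / (2 * σμ ^ 2) +
          (∑ i, ‖x i - μ‖ ^ 2) / (2 * σx ^ 2))) := by
      intro μ
      have h1 : ∀ i, isoDensity μ σx (x i) =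
          κ σx * Real.exp (-(1 / (2 * σx ^ 2)) * ‖x i - μ‖ ^ 2) := fun i => rfl
      have h2 : isoDensity μm σμ μ =
          κ σμ * Real.exp (-(1 / (2 * σμ ^ 2)) * ‖μ - μm‖ ^ 2) := rfl
      simp_rw [h1]
      rw [h2, Finset.prod_mul_distrib, ← Real.exp_sum, ← Finset.mul_sum, smul_eq_mul, neg_add,
        Real.exp_add]
      simp only [Finset.prod_const, Finset.card_univ, Fintype.card_fin]
      have e1 : -(1 / (2 * σμ ^ 2)) * ‖μ - μm‖ ^ 2 = -(‖μ - μm‖ ^ 2 / (2 * σμ ^ 2)) := by ring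
      have e2 : -(1 / (2 * σx ^ 2)) * ∑ i, ‖x i - μ‖ ^ 2 =
        -((∑ i, ‖x i - μ‖ ^ 2) / (2 * σx ^ 2)) := by ring
      rw [e1, e2]
      ring
    rw [integral_isoGaussian _ hσμ]
    simp_rw [hint]
    rw [integral_const_mul, integral_exp_neg_translate (Q := fun v => b * ‖v‖ ^ 2)
      (fun μ => mean_exponent_eq hσμ hσx x μs μm μ), neg_add, Real.exp_add]
    ring

/-- The quadratic part `Q` is the same for every component; only its vertex `ws + u` and its minimum
depend on `wm`. Hence one `Z` serves all components and both moments. -/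
lemma exists_integral_prod_gaussianPDFReal {n : ℕ} {σw σy : ℝ} (hσw : 0 < σw) (hσy : 0 < σy)
    (x : Fin n → Vec d) (ws : Vec d) :
    ∃ Z : ℝ, 0 < Z ∧ ∀ wm u : Vec d,
      u + (σw ^ 2 / σy ^ 2) • ∑ i, inner ℝ (x i) u • x i = wm - ws →
      ∫ w, ∏ i, gaussianPDFReal (inner ℝ w (x i)) (σy ^ 2).toNNReal (inner ℝ (x i) ws)
        ∂(isoGaussian wm σw) =
          Z * Real.exp (-((‖wm - ws‖ ^ 2 - inner ℝ u (wm - ws)) / (2 * σw ^ 2))) ∧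
      ∫ w, (∏ i, gaussianPDFReal (inner ℝ w (x i)) (σy ^ 2).toNNReal (inner ℝ (x i) ws)) • w
        ∂(isoGaussian wm σw) =
          (Z * Real.exp (-((‖wm - ws‖ ^ 2 - inner ℝ u (wm - ws)) / (2 * σw ^ 2)))) • (ws + u) := by
  set κ : ℝ := (∫ v : Vec d, Real.exp (-(1 / (2 * σw ^ 2)) * ‖v‖ ^ 2))⁻¹ with hκ
  have hκpos : 0 < κ := inv_pos.2 (integral_exp_neg_mul_norm_sq_pos (by positivity))
  set κy : ℝ := (√(2 * Real.pi * (σy ^ 2).toNNReal))⁻¹ with hκy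
  have hκypos : 0 < κy := by
    have : 0 < (σy ^ 2).toNNReal := Real.toNNReal_pos.2 (by positivity)
    positivity
  set Q : Vec d → ℝ := fun v =>
    (‖v‖ ^ 2 + σw ^ 2 / σy ^ 2 * ∑ i, inner ℝ (x i) v ^ 2) / (2 * σw ^ 2) with hQ
  have hQc : Continuous Q := by fun_prop
  have hQe : ∀ v, Q (-v) = Q v := fun v => by simp [Q]
  have hQle : ∀ v, 1 / (2 * σw ^ 2) * ‖v‖ ^ 2 ≤ Q v := by
    intro v
    simp only [Q]
    rw [one_div_mul_eq_div]
    gcongr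
    have : 0 ≤ σw ^ 2 / σy ^ 2 * ∑ i, inner ℝ (x i) v ^ 2 := by positivity
    linarith
  have hb : 0 < 1 / (2 * σw ^ 2) := by positivity
  refine ⟨κ * κy ^ n * ∫ v : Vec d, Real.exp (-Q v), ?_, fun wm u hu => ?_⟩
  · have := integral_exp_pos (integrable_exp_neg_of_le hQc hb hQle)
    positivity
  · have hint : ∀ w : Vec d, isoDensity wm σw w *
        ∏ i, gaussianPDFReal (inner ℝ w (x i)) (σy ^ 2).toNNReal (inner ℝ (x i) ws) =
        κ * κy ^ n * Real.exp (-(‖w - wm‖ ^ 2 / (2 * σw ^ 2) +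
          (∑ i, (inner ℝ (x i) ws - inner ℝ w (x i)) ^ 2) / (2 * σy ^ 2))) := by
      intro w
      have h1 : ∀ i, gaussianPDFReal (inner ℝ w (x i)) (σy ^ 2).toNNReal (inner ℝ (x i) ws) =
          κy * Real.exp (-(1 / (2 * σy ^ 2)) * (inner ℝ (x i) ws - inner ℝ w (x i)) ^ 2) := by
        intro i
        rw [gaussianPDFReal, hκy]
        congr 2
        rw [Real.coe_toNNReal _ (sq_nonneg σy)]
        ring
      have h2 : isoDensity wm σw w =
          κ * Real.exp (-(1 / (2 * σw ^ 2)) * ‖w - wm‖ ^ 2) := rfl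
      simp_rw [h1]
      rw [h2, Finset.prod_mul_distrib, ← Real.exp_sum, ← Finset.mul_sum, neg_add, Real.exp_add]
      simp only [Finset.prod_const, Finset.card_univ, Fintype.card_fin]
      have e1 : -(1 / (2 * σw ^ 2)) * ‖w - wm‖ ^ 2 = -(‖w - wm‖ ^ 2 / (2 * σw ^ 2)) := by ring
      have e2 : -(1 / (2 * σy ^ 2)) * ∑ i, (inner ℝ (x i) ws - inner ℝ w (x i)) ^ 2 =
        -((∑ i, (inner ℝ (x i) ws - inner ℝ w (x i)) ^ 2) / (2 * σy ^ 2)) := by ring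
      rw [e1, e2]
      ring
    have hh := fun w => regression_exponent_eq hσw hσy hu w
    rw [integral_isoGaussian _ hσw, integral_isoGaussian _ hσw]
    simp_rw [smul_smul, smul_eq_mul, hint]
    constructor
    · rw [integral_const_mul, integral_exp_neg_translate (Q := Q) hh]
      ring
    · simp_rw [mul_smul (κ * κy ^ n)]
      rw [integral_smul, integral_exp_neg_smul_translate hQc hQe hb hQle hh, smul_smul]
      congr 1
      ring

/-- The negative log-evidence of the component with centers `(μm, wm)`, up to a constant that does
not depend on the component, for a prompt with inputs `x` labeled by `ws`; `u` is the deviation of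
the posterior mean of the regression vector from `ws`. -/
def energy (σμ σw σx : ℝ) (μs ws : Vec d) {n : ℕ} (x : Fin n → Vec d) (μm wm u : Vec d) : ℝ :=
  (n * ‖μm - μs‖ ^ 2 - 2 * inner ℝ (μm - μs) (∑ i, (x i - μs))) /
      (2 * σx ^ 2 * (1 + n * (σμ ^ 2 / σx ^ 2))) +
    (‖wm - ws‖ ^ 2 - inner ℝ u (wm - ws)) / (2 * σw ^ 2)

/-- On a prompt that is labeled without noise by `ws`, an optimally pretrained predictor is linear
in the query, with the posterior mixture of the ridge estimates of the components. -/
theorem IsOptimalPredictor.eq_inner {M : ℕ} {p : Fin M → ℝ} {μc wc : Fin M → Vec d}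
    {σμ σw σx σy : ℝ} (hp : ∀ m, 0 < p m) (hsum : ∑ m, p m = 1)
    (hσμ : 0 < σμ) (hσw : 0 < σw) (hσx : 0 < σx) (hσy : 0 < σy) {F : Predictor d}
    (hF : IsOptimalPredictor (taskPrior p μc wc σμ σw) σx σy F) (μs ws : Vec d) {k : ℕ}
    (x : Fin (k + 1) → Vec d) {u : Fin M → Vec d}
    (hu : ∀ m, u m + (σw ^ 2 / σy ^ 2) •
      ∑ i : Fin k, inner ℝ (x i.castSucc) (u m) • x i.castSucc = wc m - ws) :
    F k (fun i => (x i.castSucc, inner ℝ (x i.castSucc) ws)) (x (Fin.last k)) =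
      inner ℝ (ws + ∑ m, (p m * Real.exp (-energy σμ σw σx μs ws x (μc m) (wc m) (u m)) /
        ∑ j, p j * Real.exp (-energy σμ σw σx μs ws x (μc j) (wc j) (u j))) • u m)
        (x (Fin.last k)) := by
  have hprob : IsProbabilityMeasure (taskPrior p μc wc σμ σw) :=
    isProbabilityMeasure_taskPrior hp hsum
  have hw : Integrable (fun t => t.2) (taskPrior p μc wc σμ σw) :=
    integrable_taskPrior fun m => integrable_snd_prod_isoGaussian _ _ _ _
  rw [hF.eq_bayesPredictor hσx hσy hw integrable_snd_sq_taskPrior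
    (integrable_moment_taskPrior _ _), bayesPredictor]
  -- The query carries information on the input mean but has no label, so `k + 1` inputs enter the
  -- factor of `μ` and `k` labels that of `w`.
  obtain ⟨Zμ, hZμ, hμ⟩ := exists_integral_prod_isoDensity hσμ hσx x μs
  obtain ⟨Zw, hZw, hw⟩ :=
    exists_integral_prod_gaussianPDFReal hσw hσy (fun i : Fin k => x i.castSucc) ws
  set q : (Fin k → Vec d × ℝ) × Vec d :=
    (fun i => (x i.castSucc, inner ℝ (x i.castSucc) ws), x (Fin.last k)) with hq
  set G : Vec d → ℝ := fun w => ∏ i : Fin k,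
    gaussianPDFReal (inner ℝ w (x i.castSucc)) (σy ^ 2).toNNReal (inner ℝ (x i.castSucc) ws) with hG
  set A : Vec d → ℝ := fun μ => ∏ i, isoDensity μ σx (x i) with hA
  have hL : ∀ t : Vec d × Vec d, likelihood σx σy t q = A t.1 * G t.2 := by
    intro t
    simp only [likelihood, sampleDensity, hq, hA, hG, Finset.prod_mul_distrib,
      Fin.prod_univ_castSucc]
    ring
  set E : Fin M → ℝ := fun m => energy σμ σw σx μs ws x (μc m) (wc m) (u m) with hE
  have hev : evidence (taskPrior p μc wc σμ σw) σx σy q =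
      Zμ * Zw * ∑ m, p m * Real.exp (-E m) := by
    rw [evidence, integral_taskPrior hp fun m => integrable_likelihood hσx hσy q, Finset.mul_sum]
    refine Finset.sum_congr rfl fun m _ => ?_
    simp_rw [hL]
    rw [integral_prod_mul, hμ, (hw _ _ (hu m)).1, smul_eq_mul]
    simp only [hE, energy]
    rw [neg_add, Real.exp_add]
    ring
  have hwt : weightedTask (taskPrior p μc wc σμ σw) σx σy q =
      ∑ m, (Zμ * Zw * (p m * Real.exp (-E m))) • (ws + u m) := by
    rw [weightedTask, integral_taskPrior hp fun m =>
      integrable_likelihood_smul hσx hσy q (integrable_snd_prod_isoGaussian _ _ _ _)]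
    refine Finset.sum_congr rfl fun m _ => ?_
    simp_rw [hL, mul_smul (A _)]
    rw [integral_prod_smul A (fun w => G w • w), hμ, (hw _ _ (hu m)).2, smul_smul, smul_smul]
    congr 1
    simp only [hE, energy]
    rw [neg_add, Real.exp_add]
    ring
  have hM : (Finset.univ : Finset (Fin M)).Nonempty := by
    rw [Finset.univ_nonempty_iff]
    by_contra hne
    rw [not_nonempty_iff] at hne
    simp at hsum
  have hT : 0 < ∑ m, p m * Real.exp (-E m) :=
    Finset.sum_pos (fun m _ => mul_pos (hp m) (Real.exp_pos _)) hM
  rw [hev, hwt]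
  set T := ∑ m, p m * Real.exp (-E m) with hTdef
  have hone : ∑ m, p m * Real.exp (-E m) / T = 1 := by
    rw [← Finset.sum_div, div_self hT.ne']
  have hfin : ∑ m, (Zμ * Zw * (p m * Real.exp (-E m))) • (ws + u m) =
      (Zμ * Zw * T) • (ws + ∑ m, (p m * Real.exp (-E m) / T) • u m) := by
    have h1 : ws = ∑ m, (p m * Real.exp (-E m) / T) • ws := by
      rw [← Finset.sum_smul, hone, one_smul]
    conv_rhs => rw [h1]
    rw [← Finset.sum_add_distrib, Finset.smul_sum]
    refine Finset.sum_congr rfl fun m _ => ?_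
    rw [← smul_add, smul_smul]
    congr 1
    field_simp
  rw [hfin, inner_smul_left]
  simp only [conj_trivial]
  rw [mul_div_cancel_left₀ _ (by positivity)]

end ClosedForm

/-! ### Estimates for the ridge equation. -/

section Ridge

variable {d n : ℕ} {δ : ℝ} {x : Fin n → Vec d} {e u : Vec d}

lemma inner_self_ridge (hu : u + δ • ∑ i, inner ℝ (x i) u • x i = e) :
    inner ℝ u e = ‖u‖ ^ 2 + δ * ∑ i, inner ℝ (x i) u ^ 2 := by
  have h := inner_ridge_solution hu u
  rw [real_inner_comm, real_inner_self_eq_norm_sq] at h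
  simpa only [sq] using h

/-- Since `⟨u, e⟩ ≥ ‖u‖²`, the point `u` lies in the ball that has the segment from `0` to `e` as
diameter. -/
lemma norm_sq_add_norm_sub_sq_le (hδ : 0 ≤ δ)
    (hu : u + δ • ∑ i, inner ℝ (x i) u • x i = e) : ‖u‖ ^ 2 + ‖u - e‖ ^ 2 ≤ ‖e‖ ^ 2 := by
  have h := inner_self_ridge hu
  have h0 : 0 ≤ δ * ∑ i, inner ℝ (x i) u ^ 2 := by positivity
  rw [norm_sub_sq_real]
  linarith

lemma norm_ridge_le (hδ : 0 ≤ δ) (hu : u + δ • ∑ i, inner ℝ (x i) u • x i = e) : ‖u‖ ≤ ‖e‖ := by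
  have h := norm_sq_add_norm_sub_sq_le hδ hu
  exact abs_le_of_sq_le_sq' (by nlinarith [sq_nonneg ‖u - e‖]) (norm_nonneg _) |>.2

lemma norm_ridge_sub_le (hδ : 0 ≤ δ) (hu : u + δ • ∑ i, inner ℝ (x i) u • x i = e) :
    ‖u - e‖ ≤ ‖e‖ := by
  have h := norm_sq_add_norm_sub_sq_le hδ hu
  exact abs_le_of_sq_le_sq' (by nlinarith [sq_nonneg ‖u‖]) (norm_nonneg _) |>.2

lemma mul_norm_ridge_le (hδ : 0 ≤ δ) (hu : u + δ • ∑ i, inner ℝ (x i) u • x i = e) {a : ℝ}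
    (ha : ∀ v, a * ‖v‖ ^ 2 ≤ ∑ i, inner ℝ (x i) v ^ 2) : (1 + δ * a) * ‖u‖ ≤ ‖e‖ := by
  have h := inner_self_ridge hu
  have h1 := mul_le_mul_of_nonneg_left (ha u) hδ
  have h2 := real_inner_le_norm u e
  rcases (norm_nonneg u).eq_or_lt with h0 | h0
  · rw [← h0]; simp
  · nlinarith

/-- Test with `e - u` and apply Cauchy–Schwarz to the second-moment form. For short prompts this
says that the data have hardly moved the estimate from its prior center. -/
lemma norm_ridge_sub_le_mul (hδ : 0 ≤ δ) (hu : u + δ • ∑ i, inner ℝ (x i) u • x i = e) {b : ℝ}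
    (hb0 : 0 ≤ b) (hb : ∀ v, ∑ i, inner ℝ (x i) v ^ 2 ≤ b * ‖v‖ ^ 2) :
    ‖u - e‖ ≤ δ * b * ‖e‖ := by
  have h1 := inner_ridge_solution hu (e - u)
  have h2 : ‖e - u‖ ^ 2 = δ * ∑ i, inner ℝ (x i) u * inner ℝ (x i) (e - u) := by
    rw [← real_inner_self_eq_norm_sq, inner_sub_left]
    linarith
  have h3 : (∑ i, inner ℝ (x i) u * inner ℝ (x i) (e - u)) ^ 2 ≤
      (b * ‖u‖ * ‖e - u‖) ^ 2 := by
    refine (Finset.sum_mul_sq_le_sq_mul_sq _ _ _).trans ?_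
    calc _ ≤ (b * ‖u‖ ^ 2) * (b * ‖e - u‖ ^ 2) :=
          mul_le_mul (hb u) (hb _) (Finset.sum_nonneg fun _ _ => sq_nonneg _) (by positivity)
      _ = _ := by ring
  have h4 := (abs_le_of_sq_le_sq' h3 (by positivity)).2
  have h5 := mul_le_mul_of_nonneg_left h4 hδ
  have h6 : δ * b * ‖u‖ ≤ δ * b * ‖e‖ :=
    mul_le_mul_of_nonneg_left (norm_ridge_le hδ hu) (by positivity)
  rw [norm_sub_rev]
  rcases (norm_nonneg (e - u)).eq_or_lt with h0 | h0
  · rw [← h0]; positivity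
  · refine le_trans ?_ h6
    nlinarith

/-- With `A` the ridge operator and `c = 1 + δ b`, this is the implication from `A ≤ c` to `A⁻¹ ≥
c⁻¹`. It follows by expanding `⟨A (c u - e), c u - e⟩ ≥ 0` with `A u = e`. -/
lemma div_le_inner_ridge (hδ : 0 ≤ δ) (hu : u + δ • ∑ i, inner ℝ (x i) u • x i = e) {b : ℝ}
    (hb0 : 0 ≤ b) (hb : ∀ v, ∑ i, inner ℝ (x i) v ^ 2 ≤ b * ‖v‖ ^ 2) :
    ‖e‖ ^ 2 ≤ (1 + δ * b) * inner ℝ u e := by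
  set c := 1 + δ * b with hc
  have hcpos : 0 < c := by positivity
  have h1 := inner_self_ridge hu
  have h2 := inner_ridge_solution hu e
  rw [real_inner_self_eq_norm_sq] at h2
  have h3 : 0 ≤ ‖c • u - e‖ ^ 2 + δ * ∑ i, inner ℝ (x i) (c • u - e) ^ 2 := by positivity
  have h4 : ∑ i, inner ℝ (x i) (c • u - e) ^ 2 = c ^ 2 * ∑ i, inner ℝ (x i) u ^ 2 -
      2 * c * ∑ i, inner ℝ (x i) u * inner ℝ (x i) e + ∑ i, inner ℝ (x i) e ^ 2 := by
    simp_rw [inner_sub_right, inner_smul_right]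
    rw [Finset.mul_sum, Finset.mul_sum, ← Finset.sum_sub_distrib, ← Finset.sum_add_distrib]
    exact Finset.sum_congr rfl fun i _ => by ring
  rw [h4, norm_sub_sq_real, norm_smul, inner_smul_left, Real.norm_of_nonneg hcpos.le] at h3
  simp only [conj_trivial] at h3
  have h5 := mul_le_mul_of_nonneg_left (hb e) hδ
  have h6 : 0 ≤ c ^ 2 * inner ℝ u e - c * ‖e‖ ^ 2 := by
    rw [h1]
    have : ‖e‖ ^ 2 + δ * (b * ‖e‖ ^ 2) = c * ‖e‖ ^ 2 := by rw [hc]; ring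
    nlinarith
  nlinarith

/-- If the second-moment form is pinched between `a` and `b` and `b ‖e‖² ≤ a ‖e'‖²`, then the
residual energy of `e` is at most that of `e'`. -/
lemma ridge_residual_le (hδ : 0 ≤ δ) {e' u' : Vec d}
    (hu : u + δ • ∑ i, inner ℝ (x i) u • x i = e)
    (hu' : u' + δ • ∑ i, inner ℝ (x i) u' • x i = e') {a b : ℝ} (ha0 : 0 ≤ a) (hab : a ≤ b)
    (ha : ∀ v, a * ‖v‖ ^ 2 ≤ ∑ i, inner ℝ (x i) v ^ 2)
    (hb : ∀ v, ∑ i, inner ℝ (x i) v ^ 2 ≤ b * ‖v‖ ^ 2)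
    (hle : b * ‖e‖ ^ 2 ≤ a * ‖e'‖ ^ 2) :
    ‖e‖ ^ 2 - inner ℝ u e ≤ ‖e'‖ ^ 2 - inner ℝ u' e' := by
  have hb0 : 0 ≤ b := ha0.trans hab
  have hca : 0 < 1 + δ * a := by positivity
  have hcb : 0 < 1 + δ * b := by positivity
  have h1 := div_le_inner_ridge hδ hu hb0 hb
  have h2 : (1 + δ * a) * inner ℝ u' e' ≤ ‖e'‖ ^ 2 := by
    have := mul_norm_ridge_le hδ hu' ha
    have h3 := real_inner_le_norm u' e'
    nlinarith [norm_nonneg e']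
  -- The two fractions bounding the residuals compare because `hle` orders the numerators and `a ≤
  -- b` the denominators.
  have h3 : ‖e‖ ^ 2 - inner ℝ u e ≤ δ * (b * ‖e‖ ^ 2) / (1 + δ * b) := by
    rw [le_div_iff₀ hcb]; nlinarith
  have h4 : δ * (a * ‖e'‖ ^ 2) / (1 + δ * a) ≤ ‖e'‖ ^ 2 - inner ℝ u' e' := by
    rw [div_le_iff₀ hca]; nlinarith
  refine h3.trans (le_trans ?_ h4)
  gcongr

end Ridge

/-! ### Posterior weights and energy gaps. -/

section PosteriorBounds

variable {d : ℕ}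

lemma norm_sum_smul_sq_le {ι : Type*} [Fintype ι] {q : ι → ℝ} (hq : ∀ i, 0 ≤ q i)
    (hq1 : ∑ i, q i = 1) (v : ι → Vec d) : ‖∑ i, q i • v i‖ ^ 2 ≤ ∑ i, q i * ‖v i‖ ^ 2 := by
  have h1 : ‖∑ i, q i • v i‖ ≤ ∑ i, q i * ‖v i‖ :=
    (norm_sum_le _ _).trans (le_of_eq (Finset.sum_congr rfl fun i _ => by
      rw [norm_smul, Real.norm_of_nonneg (hq i)]))
  have h2 := (even_two.convexOn_pow (𝕜 := ℝ)).map_sum_le (t := Finset.univ) (w := q)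
    (p := fun i => ‖v i‖) (fun i _ => hq i) hq1 fun i _ => Set.mem_univ _
  simp only [smul_eq_mul] at h2
  exact (pow_le_pow_left₀ (norm_nonneg _) h1 2).trans h2

lemma norm_sum_smul_le {ι : Type*} [Fintype ι] {q : ι → ℝ} (hq : ∀ i, 0 ≤ q i)
    (hq1 : ∑ i, q i = 1) {v : ι → Vec d} {R : ℝ} (hv : ∀ i, ‖v i‖ ≤ R) :
    ‖∑ i, q i • v i‖ ≤ R := by
  calc ‖∑ i, q i • v i‖ ≤ ∑ i, q i * R := (norm_sum_le _ _).trans (Finset.sum_le_sum fun i _ => by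
        rw [norm_smul, Real.norm_of_nonneg (hq i)]; exact mul_le_mul_of_nonneg_left (hv i) (hq i))
    _ = R := by rw [← Finset.sum_mul, hq1, one_mul]

/-- Only the term of `α` is kept in the partition function. -/
lemma gibbs_weight_le {ι : Type*} [Fintype ι] {p E : ι → ℝ} (hp : ∀ i, 0 < p i)
    (hp1 : ∀ i, p i ≤ 1) (α β : ι) {c : ℝ} (hc : c ≤ E β - E α) :
    p β * Real.exp (-E β) / ∑ j, p j * Real.exp (-E j) ≤ (p α)⁻¹ * Real.exp (-c) := by
  have h1 : p α * Real.exp (-E α) ≤ ∑ j, p j * Real.exp (-E j) :=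
    Finset.single_le_sum (f := fun j => p j * Real.exp (-E j))
      (fun j _ => mul_nonneg (hp j).le (Real.exp_pos _).le) (Finset.mem_univ α)
  have h2 : 0 < p α * Real.exp (-E α) := mul_pos (hp α) (Real.exp_pos _)
  calc _ ≤ 1 * Real.exp (-E β) / (p α * Real.exp (-E α)) := by
        gcongr
        exact hp1 β
    _ = (p α)⁻¹ * Real.exp (-(E β - E α)) := by
        rw [neg_sub, sub_eq_add_neg, Real.exp_add, Real.exp_neg (E α)]
        have := hp α
        field_simp
    _ ≤ _ := by
        have := hp α
        gcongr

/-- The energy gap between two components, if the second-moment form and the empirical mean of the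
inputs are close to their expectations. -/
lemma le_energy_sub {σμ σw σx δ : ℝ} (hσx : 0 < σx) (hσw : 0 < σw) (hδ : 0 ≤ δ)
    {μs ws : Vec d} {k : ℕ} {x : Fin (k + 1) → Vec d} {μα wα uα μβ wβ uβ : Vec d}
    (huα : uα + δ • ∑ i : Fin k, inner ℝ (x i.castSucc) uα • x i.castSucc = wα - ws)
    (huβ : uβ + δ • ∑ i : Fin k, inner ℝ (x i.castSucc) uβ • x i.castSucc = wβ - ws)
    {a b : ℝ} (ha0 : 0 ≤ a) (hab : a ≤ b)
    (ha : ∀ v, a * ‖v‖ ^ 2 ≤ ∑ i : Fin k, inner ℝ (x i.castSucc) v ^ 2)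
    (hb : ∀ v, ∑ i : Fin k, inner ℝ (x i.castSucc) v ^ 2 ≤ b * ‖v‖ ^ 2)
    (hle : b * ‖wα - ws‖ ^ 2 ≤ a * ‖wβ - ws‖ ^ 2) {dμ : ℝ}
    (hdμ : dμ ^ 2 ≤ ‖μβ - μs‖ ^ 2 - ‖μα - μs‖ ^ 2)
    (hmean : inner ℝ (μβ - μα) (∑ i, (x i - μs)) ≤ (k + 1 : ℕ) * (dμ ^ 2 / 4))
    (hk : (k + 1 : ℕ) * (σμ ^ 2 / σx ^ 2) ≤ 1) :
    (k + 1 : ℕ) * (dμ ^ 2 / (8 * σx ^ 2)) ≤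
      energy σμ σw σx μs ws x μβ wβ uβ - energy σμ σw σx μs ws x μα wα uα := by
  have h1 := ridge_residual_le hδ huα huβ ha0 hab ha hb hle
  have h2 := div_le_div_of_nonneg_right h1 (by positivity : 0 ≤ 2 * σw ^ 2)
  have hin : inner ℝ (μβ - μα) (∑ i, (x i - μs)) =
      inner ℝ (μβ - μs) (∑ i, (x i - μs)) - inner ℝ (μα - μs) (∑ i, (x i - μs)) := by
    rw [← inner_sub_left]; congr 1; abel
  rw [hin] at hmean
  unfold energy
  set N : ℝ := ((k + 1 : ℕ) : ℝ) with hN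
  have hN0 : 0 ≤ N := Nat.cast_nonneg _
  set r := N * (σμ ^ 2 / σx ^ 2) with hr
  have hr0 : 0 ≤ r := by positivity
  -- The fluctuation of the mean takes half of the margin `dμ²`, and `1 + r ≤ 2` halves the rest,
  -- which turns `2 σx²` into `8 σx²`. The regression part enters only through its sign.
  have h3 : N * (dμ ^ 2 / (8 * σx ^ 2)) ≤
      (N * ‖μβ - μs‖ ^ 2 - 2 * inner ℝ (μβ - μs) (∑ i, (x i - μs))) / (2 * σx ^ 2 * (1 + r)) -
      (N * ‖μα - μs‖ ^ 2 - 2 * inner ℝ (μα - μs) (∑ i, (x i - μs))) / (2 * σx ^ 2 * (1 + r)) := by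
    rw [← sub_div, le_div_iff₀ (by positivity)]
    have h4 : N * (dμ ^ 2 / (8 * σx ^ 2)) * (2 * σx ^ 2 * (1 + r)) =
        N * dμ ^ 2 * (1 + r) / 4 := by field_simp; ring
    rw [h4]
    have h5 := mul_le_mul_of_nonneg_left hdμ hN0
    have h6 : N * dμ ^ 2 * (1 + r) ≤ N * dμ ^ 2 * 2 :=
      mul_le_mul_of_nonneg_left (by linarith) (by positivity)
    linarith
  linarith

end PosteriorBounds

/-! ### Typical prompts and the cost of atypical ones. -/

section GoodEvent

variable {d : ℕ}

/-- Outside an event of exponentially small probability, the inputs of a prompt have second moments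
and means close to their expectations. -/
lemma exists_good_event {J : Type*} [Fintype J] {m : Vec d} (hm : ‖m‖ = 1) (τ : ℝ) (a : J → Vec d)
    {ε η : ℝ} (hε : 0 < ε) (hη : 0 < η) :
    ∃ C ρ : ℝ, 0 ≤ C ∧ 0 < ρ ∧ ρ < 1 ∧ ∀ k : ℕ, ∃ B : Set (Fin (k + 1) → Vec d),
      MeasurableSet B ∧
      (Measure.pi fun _ : Fin (k + 1) => isoGaussian m τ).real B ≤ C * ρ ^ k ∧
      ∀ x ∉ B,
        (∀ v, k * (τ ^ 2 - ε) * ‖v‖ ^ 2 ≤ ∑ i : Fin k, inner ℝ (x i.castSucc) v ^ 2) ∧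
        (∀ v, ∑ i : Fin k, inner ℝ (x i.castSucc) v ^ 2 ≤ k * (1 + τ ^ 2 + ε) * ‖v‖ ^ 2) ∧
        ∀ j, inner ℝ (a j) (∑ i, (x i - m)) ≤ (k + 1 : ℕ) * η := by
  obtain ⟨C₁, ρ₁, hC₁, hρ₁, hρ₁', h₁⟩ := exists_second_moment_concentration m τ hε
  obtain ⟨C₂, ρ₂, hC₂, hρ₂, hρ₂', h₂⟩ := exists_mean_concentration m τ a hη
  refine ⟨C₁ + C₂, max ρ₁ ρ₂, by positivity, lt_max_of_lt_left hρ₁, max_lt hρ₁' hρ₂', fun k => ?_⟩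
  obtain ⟨B₁, hB₁, hP₁, hx₁⟩ := h₁ (k + 1) (Finset.univ.map Fin.castSuccEmb)
  obtain ⟨B₂, hB₂, hP₂, hx₂⟩ := h₂ (k + 1)
  simp only [Finset.card_map, Finset.card_univ, Fintype.card_fin, Finset.sum_map,
    Fin.coe_castSuccEmb] at hP₁ hx₁
  refine ⟨B₁ ∪ B₂, hB₁.union hB₂, (measureReal_union_le _ _).trans ?_, fun x hx => ?_⟩
  · have e1 : C₁ * ρ₁ ^ k ≤ C₁ * max ρ₁ ρ₂ ^ k :=
      mul_le_mul_of_nonneg_left (pow_le_pow_left₀ hρ₁.le (le_max_left _ _) _) hC₁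
    have e2 : C₂ * ρ₂ ^ (k + 1) ≤ C₂ * max ρ₁ ρ₂ ^ k :=
      mul_le_mul_of_nonneg_left ((pow_le_pow_of_le_one hρ₂.le hρ₂'.le (Nat.le_succ k)).trans
        (pow_le_pow_left₀ hρ₂.le (le_max_right _ _) _)) hC₂
    linarith
  · rw [Set.mem_union, not_or] at hx
    have hv := hx₁ x hx.1
    refine ⟨fun v => ?_, fun v => ?_, hx₂ x hx.2⟩
    · have := (abs_le.1 (hv v)).1
      have h0 : 0 ≤ (k : ℝ) * inner ℝ m v ^ 2 := by positivity
      linarith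
    · have := (abs_le.1 (hv v)).2
      have h0 : inner ℝ m v ^ 2 ≤ ‖v‖ ^ 2 := by
        have := abs_real_inner_le_norm m v
        rw [hm, one_mul] at this
        rw [← sq_abs]
        exact pow_le_pow_left₀ (abs_nonneg _) this 2
      have h1 := mul_le_mul_of_nonneg_left h0 (Nat.cast_nonneg (α := ℝ) k)
      linarith

/-- On `B`, the inequality `2 ‖y‖² ≤ l + ‖y‖⁴ / l` separates the unbounded error from the
probability of `B`. The parameter `l` is chosen later to balance the two. -/
lemma lintegral_ofReal_le_of_event {ν : Measure (Vec d)} [IsProbabilityMeasure ν] {k : ℕ}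
    {g : (Fin (k + 1) → Vec d) → ℝ} {h : Vec d → ℝ} (hh0 : ∀ y, 0 ≤ h y) (hh : Integrable h ν)
    (h4 : Integrable (fun y => ‖y‖ ^ 4) ν) {B : Set (Fin (k + 1) → Vec d)} (hB : MeasurableSet B)
    (hgood : ∀ x ∉ B, g x ≤ h (x (Fin.last k))) (hbad : ∀ x, g x ≤ 16 * ‖x (Fin.last k)‖ ^ 2)
    {l : ℝ} (hl : 0 < l) :
    ∫⁻ x, ENNReal.ofReal (g x) ∂(Measure.pi fun _ => ν) ≤
      ENNReal.ofReal (∫ y, h y ∂ν + 8 * (l * (Measure.pi fun _ : Fin (k + 1) => ν).real B +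
        (∫ y, ‖y‖ ^ 4 ∂ν) / l)) := by
  have hmp := measurePreserving_eval (fun _ : Fin (k + 1) => ν) (Fin.last k)
  have hle : ∀ x, g x ≤ h (x (Fin.last k)) + 8 * (l * B.indicator (fun _ => (1 : ℝ)) x +
      ‖x (Fin.last k)‖ ^ 4 / l) := by
    intro x
    by_cases hx : x ∈ B
    · rw [Set.indicator_of_mem hx]
      have h1 : 16 * ‖x (Fin.last k)‖ ^ 2 ≤ 8 * (l * 1 + ‖x (Fin.last k)‖ ^ 4 / l) := by
        rw [← sub_nonneg]
        have : 8 * (l * 1 + ‖x (Fin.last k)‖ ^ 4 / l) - 16 * ‖x (Fin.last k)‖ ^ 2 =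
            8 / l * (l - ‖x (Fin.last k)‖ ^ 2) ^ 2 := by field_simp; ring
        rw [this]
        positivity
      linarith [hbad x, hh0 (x (Fin.last k))]
    · rw [Set.indicator_of_notMem hx]
      have : 0 ≤ 8 * (l * 0 + ‖x (Fin.last k)‖ ^ 4 / l) := by positivity
      linarith [hgood x hx]
  have i1 : Integrable (fun x : Fin (k + 1) → Vec d => h (x (Fin.last k)))
      (Measure.pi fun _ => ν) := hmp.integrable_comp_of_integrable hh
  have i2 : Integrable (fun x : Fin (k + 1) → Vec d => ‖x (Fin.last k)‖ ^ 4)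
      (Measure.pi fun _ => ν) := hmp.integrable_comp_of_integrable h4
  have i3 : Integrable (B.indicator fun _ => (1 : ℝ)) (Measure.pi fun _ : Fin (k + 1) => ν) :=
    (integrable_const _).indicator hB
  have i4 : Integrable (fun x : Fin (k + 1) → Vec d => l * B.indicator (fun _ => (1 : ℝ)) x +
      ‖x (Fin.last k)‖ ^ 4 / l) (Measure.pi fun _ => ν) := (i3.const_mul l).add (i2.div_const l)
  have i5 : Integrable (fun x : Fin (k + 1) → Vec d => h (x (Fin.last k)) +
      8 * (l * B.indicator (fun _ => (1 : ℝ)) x + ‖x (Fin.last k)‖ ^ 4 / l))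
      (Measure.pi fun _ => ν) := i1.add (i4.const_mul 8)
  refine (lintegral_mono fun x => ENNReal.ofReal_le_ofReal (hle x)).trans (le_of_eq ?_)
  rw [← ofReal_integral_eq_lintegral_ofReal i5 (ae_of_all _ fun x => ?_)]
  · congr 1
    rw [integral_add i1 (i4.const_mul 8), integral_const_mul,
      integral_add (i3.const_mul l) (i2.div_const l), integral_const_mul, integral_div,
      integral_indicator_const _ hB,
      integral_comp_eval (μ := fun _ : Fin (k + 1) => ν) (i := Fin.last k) hh.aestronglyMeasurable,
      integral_comp_eval (μ := fun _ : Fin (k + 1) => ν) (i := Fin.last k) (f := fun y => ‖y‖ ^ 4)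
        h4.aestronglyMeasurable]
    simp
  · have h1 : 0 ≤ B.indicator (fun _ => (1 : ℝ)) x :=
      Set.indicator_nonneg (fun _ _ => zero_le_one) x
    have h2 := hh0 (x (Fin.last k))
    simp only [Pi.zero_apply]
    positivity

/-- With `c = -log ρ`, the constant comes from completing the square in `c k - √k / 4`. The rate `1
/ 4` leaves room for a factor `exp (√k / 8)`. -/
lemma exists_pow_le_exp_neg_sqrt {ρ : ℝ} (h0 : 0 < ρ) (h1 : ρ < 1) :
    ∃ K : ℝ, 0 < K ∧ ∀ k : ℕ, ρ ^ k ≤ K * Real.exp (-(√k / 4)) := by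
  set c := -Real.log ρ with hc
  have hcpos : 0 < c := neg_pos.2 (Real.log_neg h0 h1)
  refine ⟨Real.exp (1 / (64 * c)), Real.exp_pos _, fun k => ?_⟩
  rw [← Real.exp_add, ← Real.exp_log (pow_pos h0 k), Real.log_pow, Real.exp_le_exp]
  have h2 : √(k : ℝ) ^ 2 = k := Real.sq_sqrt (Nat.cast_nonneg k)
  have h3 : 1 / (64 * c) + -(√(k : ℝ) / 4) + c * √(k : ℝ) ^ 2 =
      c * (√(k : ℝ) - 1 / (8 * c)) ^ 2 := by field_simp; ring
  have h4 : 0 ≤ c * (√(k : ℝ) - 1 / (8 * c)) ^ 2 := by positivity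
  rw [h2] at h3
  have h5 : Real.log ρ = -c := by rw [hc, neg_neg]
  rw [h5]
  linarith

end GoodEvent

/-! ### Pointwise error bounds on a given prompt. -/

section PromptError

variable {d M : ℕ} {p : Fin M → ℝ} {μc wc : Fin M → Vec d} {σμ σw σx σy : ℝ}
  {F : Predictor d}

/-- The error of the predictor `F` against the function `v` on the prompt with inputs `x` labeled
by `ws`. -/
def promptError (F : Predictor d) (ws v : Vec d) {k : ℕ} (x : Fin (k + 1) → Vec d) : ℝ :=
  F k (fun i => (x i.castSucc, inner ℝ (x i.castSucc) ws)) (x (Fin.last k)) -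
    inner ℝ (x (Fin.last k)) v

/-- Interface to the closed form: the error bounds need only a convex combination of ridge
deviations whose weights decay with the energy gap. -/
lemma IsOptimalPredictor.exists_posterior (hp : ∀ m, 0 < p m) (hp1 : ∀ m, p m < 1)
    (hsum : ∑ m, p m = 1) (hσμ : 0 < σμ) (hσw : 0 < σw) (hσx : 0 < σx) (hσy : 0 < σy)
    (hF : IsOptimalPredictor (taskPrior p μc wc σμ σw) σx σy F) (μs ws : Vec d) {k : ℕ}
    (x : Fin (k + 1) → Vec d) :
    ∃ (u : Fin M → Vec d) (q : Fin M → ℝ),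
      (∀ m, u m + (σw ^ 2 / σy ^ 2) •
        ∑ i : Fin k, inner ℝ (x i.castSucc) (u m) • x i.castSucc = wc m - ws) ∧
      (∀ m, 0 ≤ q m) ∧ ∑ m, q m = 1 ∧
      (∀ α β c, c ≤ energy σμ σw σx μs ws x (μc β) (wc β) (u β) -
        energy σμ σw σx μs ws x (μc α) (wc α) (u α) → q β ≤ (p α)⁻¹ * Real.exp (-c)) ∧
      ∀ v, promptError F ws v x = inner ℝ (∑ m, q m • u m - (v - ws)) (x (Fin.last k)) := by
  choose u hu using fun m => exists_ridge_solution (δ := σw ^ 2 / σy ^ 2) (by positivity)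
    (fun i : Fin k => x i.castSucc) (wc m - ws)
  set E : Fin M → ℝ := fun m => energy σμ σw σx μs ws x (μc m) (wc m) (u m) with hE
  have hM : (Finset.univ : Finset (Fin M)).Nonempty := by
    rw [Finset.univ_nonempty_iff]
    by_contra hne
    rw [not_nonempty_iff] at hne
    simp at hsum
  have hT : 0 < ∑ m, p m * Real.exp (-E m) :=
    Finset.sum_pos (fun m _ => mul_pos (hp m) (Real.exp_pos _)) hM
  refine ⟨u, fun m => p m * Real.exp (-E m) / ∑ j, p j * Real.exp (-E j), hu, fun m => ?_, ?_,
    fun α β c hc => ?_, fun v => ?_⟩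
  · exact div_nonneg (mul_nonneg (hp m).le (Real.exp_pos _).le) hT.le
  · rw [← Finset.sum_div, div_self hT.ne']
  · exact gibbs_weight_le hp (fun m => (hp1 m).le) α β hc
  · rw [promptError, hF.eq_inner hp hsum hσμ hσw hσx hσy μs ws x hu,
      real_inner_comm v (x (Fin.last k)), ← inner_sub_left]
    congr 1
    abel

lemma norm_sub_le_two {a b : Vec d} (ha : ‖a‖ = 1) (hb : ‖b‖ = 1) : ‖a - b‖ ≤ 2 :=
  (norm_sub_le a b).trans (by rw [ha, hb]; norm_num)

lemma inner_sq_le_norm_sq_mul (a b : Vec d) : inner ℝ a b ^ 2 ≤ ‖a‖ ^ 2 * ‖b‖ ^ 2 := by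
  rw [← sq_abs, ← mul_pow]
  exact pow_le_pow_left₀ (abs_nonneg _) (abs_real_inner_le_norm _ _) 2

lemma IsOptimalPredictor.promptError_sq_le (hp : ∀ m, 0 < p m) (hp1 : ∀ m, p m < 1)
    (hsum : ∑ m, p m = 1) (hwc : ∀ m, ‖wc m‖ = 1)
    (hσμ : 0 < σμ) (hσw : 0 < σw) (hσx : 0 < σx) (hσy : 0 < σy)
    (hF : IsOptimalPredictor (taskPrior p μc wc σμ σw) σx σy F) {ws : Vec d} (hws : ‖ws‖ = 1)
    (α : Fin M) {k : ℕ} (x : Fin (k + 1) → Vec d) :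
    promptError F ws (wc α) x ^ 2 ≤ 16 * ‖x (Fin.last k)‖ ^ 2 := by
  -- The reference point `0` for the means is arbitrary, since the energies are discarded. Each
  -- ridge deviation has norm at most `2`, and so has the bias, whence `16 = (2 + 2)²`.
  obtain ⟨u, q, hu, hq, hq1, -, herr⟩ :=
    hF.exists_posterior hp hp1 hsum hσμ hσw hσx hσy 0 ws x
  rw [herr]
  have hU : ‖∑ m, q m • u m‖ ≤ 2 := norm_sum_smul_le hq hq1 fun m =>
    (norm_ridge_le (by positivity) (hu m)).trans (norm_sub_le_two (hwc m) hws)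
  have h4 : ‖∑ m, q m • u m - (wc α - ws)‖ ≤ 4 :=
    (norm_sub_le _ _).trans (by linarith [norm_sub_le_two (hwc α) hws])
  refine (inner_sq_le_norm_sq_mul _ _).trans ?_
  gcongr
  nlinarith [norm_nonneg (∑ m, q m • u m - (wc α - ws))]

/-- The error on a typical short prompt. -/
lemma IsOptimalPredictor.promptError_sq_le_of_good (hp : ∀ m, 0 < p m) (hp1 : ∀ m, p m < 1)
    (hsum : ∑ m, p m = 1) (hwc : ∀ m, ‖wc m‖ = 1)
    (hσμ : 0 < σμ) (hσw : 0 < σw) (hσx : 0 < σx) (hσy : 0 < σy)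
    (hF : IsOptimalPredictor (taskPrior p μc wc σμ σw) σx σy F) {μs ws : Vec d} (hws : ‖ws‖ = 1)
    (α : Fin M) {k : ℕ} (x : Fin (k + 1) → Vec d) {a b : ℝ} (ha0 : 0 ≤ a) (hab : a ≤ b)
    (ha : ∀ v, a * ‖v‖ ^ 2 ≤ ∑ i : Fin k, inner ℝ (x i.castSucc) v ^ 2)
    (hb : ∀ v, ∑ i : Fin k, inner ℝ (x i.castSucc) v ^ 2 ≤ b * ‖v‖ ^ 2)
    (hle : ∀ β, β ≠ α → b * ‖wc α - ws‖ ^ 2 ≤ a * ‖wc β - ws‖ ^ 2) {dμ : ℝ}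
    (hdμ : ∀ β, β ≠ α → dμ ^ 2 ≤ ‖μc β - μs‖ ^ 2 - ‖μc α - μs‖ ^ 2)
    (hmean : ∀ β, inner ℝ (μc β - μc α) (∑ i, (x i - μs)) ≤ (k + 1 : ℕ) * (dμ ^ 2 / 4))
    (hk : (k + 1 : ℕ) * (σμ ^ 2 / σx ^ 2) ≤ 1) :
    promptError F ws (wc α) x ^ 2 ≤
      (‖wc α - ws‖ ^ 2 * min 1 ((σw ^ 2 / σy ^ 2 * b) ^ 2) +
        16 * M * (p α)⁻¹ * Real.exp (-((k + 1 : ℕ) * (dμ ^ 2 / (8 * σx ^ 2))))) *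
        ‖x (Fin.last k)‖ ^ 2 := by
  obtain ⟨u, q, hu, hq, hq1, hgap, herr⟩ :=
    hF.exists_posterior hp hp1 hsum hσμ hσw hσx hσy μs ws x
  set δ := σw ^ 2 / σy ^ 2 with hδdef
  have hδ : 0 ≤ δ := by positivity
  set e := wc α - ws with he
  set c := ((k + 1 : ℕ) : ℝ) * (dμ ^ 2 / (8 * σx ^ 2)) with hc
  rw [herr]
  refine (inner_sq_le_norm_sq_mul _ _).trans (mul_le_mul_of_nonneg_right ?_ (sq_nonneg _))
  have h1 : ∑ m, q m • u m - e = ∑ m, q m • (u m - e) := by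
    simp_rw [smul_sub]
    rw [Finset.sum_sub_distrib, ← Finset.sum_smul, hq1, one_smul]
  rw [h1]
  refine (norm_sum_smul_sq_le hq hq1 _).trans ?_
  have hα : ‖u α - e‖ ^ 2 ≤ ‖e‖ ^ 2 * min 1 ((δ * b) ^ 2) := by
    rw [mul_min_of_nonneg _ _ (sq_nonneg _), le_min_iff]
    constructor
    · rw [mul_one]
      exact pow_le_pow_left₀ (norm_nonneg _) (norm_ridge_sub_le hδ (hu α)) 2
    · rw [← mul_pow, mul_comm]
      exact pow_le_pow_left₀ (norm_nonneg _)
        (norm_ridge_sub_le_mul hδ (hu α) (ha0.trans hab) hb) 2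
  have hpα := hp α
  -- The component `α` is charged with full weight; every other one has squared deviation at most
  -- `16` and an exponentially small weight.
  have hterm : ∀ m, q m * ‖u m - e‖ ^ 2 ≤
      (if m = α then ‖e‖ ^ 2 * min 1 ((δ * b) ^ 2) else 0) + 16 * (p α)⁻¹ * Real.exp (-c) := by
    intro m
    have hpos : 0 ≤ 16 * (p α)⁻¹ * Real.exp (-c) := by positivity
    by_cases hm : m = α
    · subst hm
      have hqle : q m ≤ 1 := by
        rw [← hq1]; exact Finset.single_le_sum (fun j _ => hq j) (Finset.mem_univ m)
      rw [if_pos rfl]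
      nlinarith [mul_le_mul_of_nonneg_right hqle (sq_nonneg ‖u m - e‖)]
    · rw [if_neg hm, zero_add]
      have h2 : q m ≤ (p α)⁻¹ * Real.exp (-c) := hgap α m c
        (le_energy_sub hσx hσw hδ (hu α) (hu m) ha0 hab ha hb (hle m hm) (hdμ m hm) (hmean m) hk)
      have h3 : ‖u m - e‖ ≤ 4 := by
        refine (norm_sub_le _ _).trans ?_
        linarith [norm_sub_le_two (hwc α) hws, (norm_ridge_le hδ (hu m)).trans
          (norm_sub_le_two (hwc m) hws)]
      have h4 : ‖u m - e‖ ^ 2 ≤ 16 := by nlinarith [norm_nonneg (u m - e)]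
      calc q m * ‖u m - e‖ ^ 2 ≤ ((p α)⁻¹ * Real.exp (-c)) * 16 :=
            mul_le_mul h2 h4 (sq_nonneg _) (by positivity)
        _ = _ := by ring
  refine (Finset.sum_le_sum fun m _ => hterm m).trans (le_of_eq ?_)
  rw [Finset.sum_add_distrib, Finset.sum_ite_eq' Finset.univ α]
  simp
  ring

/-- The error on a typical long prompt. -/
lemma IsOptimalPredictor.promptError_sq_le_of_lower_bound (hp : ∀ m, 0 < p m)
    (hp1 : ∀ m, p m < 1) (hsum : ∑ m, p m = 1) (hwc : ∀ m, ‖wc m‖ = 1)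
    (hσμ : 0 < σμ) (hσw : 0 < σw) (hσx : 0 < σx) (hσy : 0 < σy)
    (hF : IsOptimalPredictor (taskPrior p μc wc σμ σw) σx σy F) {ws : Vec d} (hws : ‖ws‖ = 1)
    (α : Fin M) {k : ℕ} (x : Fin (k + 1) → Vec d) {a : ℝ} (ha0 : 0 ≤ a)
    (ha : ∀ v, a * ‖v‖ ^ 2 ≤ ∑ i : Fin k, inner ℝ (x i.castSucc) v ^ 2) {η : ℝ} (hη : 0 < η) :
    promptError F ws (wc α) x ^ 2 ≤
      (1 + η) * inner ℝ (wc α - ws) (x (Fin.last k)) ^ 2 +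
        (1 + η⁻¹) * (2 / (1 + σw ^ 2 / σy ^ 2 * a)) ^ 2 * ‖x (Fin.last k)‖ ^ 2 := by
  obtain ⟨u, q, hu, hq, hq1, -, herr⟩ :=
    hF.exists_posterior hp hp1 hsum hσμ hσw hσx hσy 0 ws x
  set δ := σw ^ 2 / σy ^ 2 with hδdef
  have hδ : 0 ≤ δ := by positivity
  have hpos : 0 < 1 + δ * a := by positivity
  have hU : ‖∑ m, q m • u m‖ ≤ 2 / (1 + δ * a) := norm_sum_smul_le hq hq1 fun m => by
    rw [le_div_iff₀ hpos, mul_comm]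
    exact (mul_norm_ridge_le hδ (hu m) ha).trans (norm_sub_le_two (hwc m) hws)
  rw [herr, inner_sub_left]
  set A := inner ℝ (∑ m, q m • u m) (x (Fin.last k)) with hA
  set D := inner ℝ (wc α - ws) (x (Fin.last k)) with hD
  have h1 : A ^ 2 ≤ (2 / (1 + δ * a)) ^ 2 * ‖x (Fin.last k)‖ ^ 2 :=
    (inner_sq_le_norm_sq_mul _ _).trans (by gcongr)
  -- Young's inequality keeps the coefficient of the persistent bias `D` near `1` and puts the large
  -- one on the vanishing `A`.
  have h2 : (A - D) ^ 2 ≤ (1 + η) * D ^ 2 + (1 + η⁻¹) * A ^ 2 := by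
    rw [← sub_nonneg]
    have : (1 + η) * D ^ 2 + (1 + η⁻¹) * A ^ 2 - (A - D) ^ 2 = η⁻¹ * (A + η * D) ^ 2 := by
      field_simp; ring
    rw [this]; positivity
  refine h2.trans ?_
  rw [mul_assoc (1 + η⁻¹)]
  gcongr

end PromptError

/-! ### Risk bounds for short and for long prompts. -/

section RiskBounds

variable {d M : ℕ} {p : Fin M → ℝ} {μc wc : Fin M → Vec d} {σx σy : ℝ}

lemma exists_ne_of_weight_lt_one (hp1 : ∀ m, p m < 1) (hsum : ∑ m, p m = 1) (α : Fin M) :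
    ∃ β, β ≠ α := by
  by_contra! h
  have h1 : ∑ m, p m = p α :=
    Finset.sum_eq_single α (fun b _ hb => absurd (h b) hb) (fun h => absurd (Finset.mem_univ α) h)
  exact (hp1 α).ne (h1 ▸ hsum)

/-- In dimension at most one the unit vectors are `±1`, which leaves no center farther from `ws`
than a biased one. -/
lemma two_le_dim {ws v v' : Vec d} (hws : ‖ws‖ = 1) (hv : ‖v‖ = 1) (hv' : ‖v'‖ = 1) (hne : ws ≠ v)
    (hlt : ‖v - ws‖ < ‖v' - ws‖) : 2 ≤ d := by
  by_contra! hd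
  interval_cases d
  · rw [Subsingleton.elim ws 0, norm_zero] at hws
    exact zero_ne_one hws
  · have hnorm : ∀ w : Vec 1, ‖w‖ = |w 0| := fun w => by
      rw [EuclideanSpace.norm_eq, Fin.sum_univ_one, Real.sqrt_sq_eq_abs, Real.norm_eq_abs, abs_abs]
    have h2 := norm_sub_le_two hv' hws
    have hne' : ws 0 ≠ v 0 := fun h => hne (by ext i; rw [Subsingleton.elim i 0, h])
    rw [hnorm] at hws hv
    have h3 : ‖v - ws‖ = 2 := by
      rw [hnorm, PiLp.sub_apply]
      rcases (abs_eq zero_le_one).1 hws with h | h <;>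
        rcases (abs_eq zero_le_one).1 hv with h' | h' <;>
        rw [h, h'] at hne' ⊢ <;> first | exact absurd rfl hne' | norm_num
    linarith

lemma integral_inner_sq_le {m : Vec d} (hm : ‖m‖ = 1) (τ : ℝ) (e : Vec d) :
    ∫ y, inner ℝ e y ^ 2 ∂(isoGaussian m τ) ≤ (1 + τ ^ 2) * ‖e‖ ^ 2 := by
  have h := integral_inner_mul_inner m e e τ
  simp_rw [← sq] at h
  rw [h, real_inner_self_eq_norm_sq]
  have := inner_sq_le_norm_sq_mul e m
  rw [hm] at this
  linarith

lemma exp_sqrt_mul_le {K r : ℝ} {k : ℕ} (h : r ≤ K * Real.exp (-(√k / 4))) :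
    Real.exp (√k / 8) * r ≤ K * Real.exp (-√k / 8) := by
  calc Real.exp (√k / 8) * r ≤ Real.exp (√k / 8) * (K * Real.exp (-(√k / 4))) := by gcongr
    _ = K * Real.exp (-√k / 8) := by
      rw [mul_left_comm, ← Real.exp_add]
      congr 2
      ring

/-- The risk on short prompts. -/
theorem exists_iclRisk_le_short (hp : ∀ m, 0 < p m) (hp1 : ∀ m, p m < 1) (hsum : ∑ m, p m = 1)
    (hwc : ∀ m, ‖wc m‖ = 1) (hσx : 0 < σx) (hσy : 0 < σy) {μs ws : Vec d} {τ : ℝ} (hτ : 0 < τ)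
    (hμs : ‖μs‖ = 1) (hws : ‖ws‖ = 1) (α : Fin M) {dμ uw : ℝ} (hdμ : 0 < dμ) (huw : 0 < uw)
    (hmarginμ : ∀ β, β ≠ α → dμ ^ 2 ≤ ‖μc β - μs‖ ^ 2 - ‖μc α - μs‖ ^ 2)
    (hmarginu : ∀ β, β ≠ α →
      τ ^ 2 * uw ^ 2 ≤ τ ^ 2 * ‖wc β - ws‖ ^ 2 - (1 + τ ^ 2) * ‖wc α - ws‖ ^ 2) :
    ∃ C : ℝ, 0 ≤ C ∧ ∀ σμ σw : ℝ, 0 < σμ → 0 < σw →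
      ∀ F : Predictor d, IsOptimalPredictor (taskPrior p μc wc σμ σw) σx σy F →
      ∀ k : ℕ, (k + 1 : ℕ) * (σμ ^ 2 / σx ^ 2) ≤ 1 →
        iclRisk F μs ws τ (wc α) k ≤
          ENNReal.ofReal (risingTerm (wc α - ws) τ (σw ^ 2 / σy ^ 2) k +
            C * Real.exp (-√k / 8)) := by
  -- `ε ≤ τ²` keeps the lower moment bound nonnegative, `ε ≤ 1` gives `1 + τ² + ε ≤ 2 (1 + τ²)` and
  -- hence the factor `4` of the rising term, and `8 ε ≤ τ² uw²` absorbs the errors `ε ‖wc m - ws‖²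
  -- ≤ 4 ε` of two components.
  obtain ⟨ε, hε, hε1, hε2, hε3⟩ : ∃ ε : ℝ, 0 < ε ∧ ε ≤ 1 ∧ ε ≤ τ ^ 2 ∧ 8 * ε ≤ τ ^ 2 * uw ^ 2 := by
    refine ⟨min 1 (min (τ ^ 2) (τ ^ 2 * uw ^ 2 / 8)), by positivity, min_le_left _ _,
      (min_le_right _ _).trans (min_le_left _ _), ?_⟩
    have : min 1 (min (τ ^ 2) (τ ^ 2 * uw ^ 2 / 8)) ≤ τ ^ 2 * uw ^ 2 / 8 :=
      (min_le_right _ _).trans (min_le_right _ _)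
    linarith
  obtain ⟨CB, ρ, hCB, hρ0, hρ1, hgood⟩ := exists_good_event hμs τ (fun β => μc β - μc α) hε
    (show 0 < dμ ^ 2 / 4 by positivity)
  set c := dμ ^ 2 / (8 * σx ^ 2) with hc
  have hcpos : 0 < c := by positivity
  obtain ⟨K₁, hK₁, hpow₁⟩ := exists_pow_le_exp_neg_sqrt (Real.exp_pos (-c))
    ((Real.exp_lt_exp.2 (neg_lt_zero.2 hcpos)).trans_eq Real.exp_zero)
  obtain ⟨K₂, hK₂, hpow₂⟩ := exists_pow_le_exp_neg_sqrt hρ0 hρ1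
  obtain ⟨M4, hM4⟩ : ∃ M4, M4 = ∫ y, ‖y‖ ^ 4 ∂(isoGaussian μs τ) := ⟨_, rfl⟩
  have hM4nonneg : 0 ≤ M4 := hM4 ▸ integral_nonneg fun y => by positivity
  have hpα := hp α
  refine ⟨(1 + d * τ ^ 2) * (16 * M * (p α)⁻¹ * K₁) + 8 * (CB * K₂ + M4), by positivity,
    fun σμ σw hσμ hσw F hF k hk => ?_⟩
  obtain ⟨B, hB, hPB, hx⟩ := hgood k
  set δ := σw ^ 2 / σy ^ 2 with hδ
  set H := ‖wc α - ws‖ ^ 2 * min 1 (4 * (k : ℝ) ^ 2 * δ ^ 2 * (1 + τ ^ 2) ^ 2) +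
    16 * M * (p α)⁻¹ * Real.exp (-((k + 1 : ℕ) * c)) with hH
  have hH0 : 0 ≤ H := by positivity
  have hgoodx : ∀ x ∉ B, promptError F ws (wc α) x ^ 2 ≤ H * ‖x (Fin.last k)‖ ^ 2 := by
    intro x hxB
    obtain ⟨hlow, hup, hmean⟩ := hx x hxB
    refine (hF.promptError_sq_le_of_good hp hp1 hsum hwc hσμ hσw hσx hσy hws α x
      (mul_nonneg (Nat.cast_nonneg k) (by linarith)) (by gcongr; linarith) hlow hup
      (fun β hβ => ?_) hmarginμ hmean hk).trans ?_
    · rw [mul_assoc, mul_assoc]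
      refine mul_le_mul_of_nonneg_left ?_ (Nat.cast_nonneg k)
      have h1 := norm_sub_le_two (hwc α) hws
      have h2 := norm_sub_le_two (hwc β) hws
      have h3 := hmarginu β hβ
      have h1' := mul_le_mul_of_nonneg_left (pow_le_pow_left₀ (norm_nonneg _) h1 2) hε.le
      have h2' := mul_le_mul_of_nonneg_left (pow_le_pow_left₀ (norm_nonneg _) h2 2) hε.le
      linarith
    · refine mul_le_mul_of_nonneg_right ?_ (sq_nonneg _)
      refine add_le_add_left ?_ _
      refine mul_le_mul_of_nonneg_left (min_le_min le_rfl ?_) (sq_nonneg _)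
      calc (δ * (k * (1 + τ ^ 2 + ε))) ^ 2 ≤ (δ * (k * (2 * (1 + τ ^ 2)))) ^ 2 := by
            gcongr
            linarith [sq_nonneg τ]
        _ = _ := by ring
  have hint := integrable_norm_pow_isoGaussian μs τ 2
  -- For `l = exp (√k / 8)`, both `l` times the probability of `B` and the fourth moment over `l`
  -- are of order `exp (-√k / 8)`.
  have hrisk := lintegral_ofReal_le_of_event (g := fun x => promptError F ws (wc α) x ^ 2)
    (h := fun y => H * ‖y‖ ^ 2) (fun y => by positivity) (hint.const_mul H)
    (integrable_norm_pow_isoGaussian μs τ 4) hB hgoodx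
    (hF.promptError_sq_le hp hp1 hsum hwc hσμ hσw hσx hσy hws α) (Real.exp_pos (√k / 8))
  refine hrisk.trans (ENNReal.ofReal_le_ofReal ?_)
  rw [integral_const_mul, integral_norm_sq_isoGaussian, hμs, one_pow, ← hM4]
  have e1 : Real.exp (-((k + 1 : ℕ) * c)) ≤ K₁ * Real.exp (-√k / 8) := by
    calc Real.exp (-((k + 1 : ℕ) * c)) ≤ Real.exp (-c) ^ k := by
          rw [← Real.exp_nat_mul, Real.exp_le_exp]
          push_cast
          linarith
      _ ≤ 1 * Real.exp (-c) ^ k := by rw [one_mul]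
      _ ≤ Real.exp (√k / 8) * Real.exp (-c) ^ k := by
          gcongr
          exact Real.one_le_exp (by positivity)
      _ ≤ _ := exp_sqrt_mul_le (hpow₁ k)
  have e2 : Real.exp (√k / 8) * (Measure.pi fun _ : Fin (k + 1) => isoGaussian μs τ).real B ≤
      CB * (K₂ * Real.exp (-√k / 8)) := by
    calc _ ≤ Real.exp (√k / 8) * (CB * ρ ^ k) := by gcongr
      _ = CB * (Real.exp (√k / 8) * ρ ^ k) := by ring
      _ ≤ _ := mul_le_mul_of_nonneg_left (exp_sqrt_mul_le (hpow₂ k)) hCB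
  have e3 : M4 / Real.exp (√k / 8) = M4 * Real.exp (-√k / 8) := by
    rw [div_eq_mul_inv, ← Real.exp_neg, neg_div]
  rw [e3]
  have e4 : 16 * M * (p α)⁻¹ * Real.exp (-((k + 1 : ℕ) * c)) ≤
      16 * M * (p α)⁻¹ * (K₁ * Real.exp (-√k / 8)) := by gcongr
  have e5 : H * (1 + d * τ ^ 2) ≤
      (‖wc α - ws‖ ^ 2 * min 1 (4 * (k : ℝ) ^ 2 * δ ^ 2 * (1 + τ ^ 2) ^ 2) +
        16 * M * (p α)⁻¹ * (K₁ * Real.exp (-√k / 8))) * (1 + d * τ ^ 2) := by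
    rw [hH]; gcongr
  rw [risingTerm]
  linarith

/-- The limit of the risk on long prompts. -/
theorem eventually_iclRisk_lt (hp : ∀ m, 0 < p m) (hp1 : ∀ m, p m < 1) (hsum : ∑ m, p m = 1)
    (hwc : ∀ m, ‖wc m‖ = 1) {σμ σw : ℝ} (hσμ : 0 < σμ) (hσw : 0 < σw) (hσx : 0 < σx) (hσy : 0 < σy)
    {F : Predictor d} (hF : IsOptimalPredictor (taskPrior p μc wc σμ σw) σx σy F)
    {μs ws : Vec d} {τ : ℝ} (hτ : 0 < τ) (hμs : ‖μs‖ = 1) (hws : ‖ws‖ = 1) (α : Fin M) {R : ℝ}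
    (hR : (1 + τ ^ 2) * ‖wc α - ws‖ ^ 2 < R) :
    ∀ᶠ k : ℕ in atTop, iclRisk F μs ws τ (wc α) k < ENNReal.ofReal R := by
  set L := (1 + τ ^ 2) * ‖wc α - ws‖ ^ 2 with hL
  have hL0 : 0 ≤ L := by positivity
  obtain ⟨η, hη, hηR⟩ : ∃ η : ℝ, 0 < η ∧ (1 + η) * L < R := by
    refine ⟨(R - L) / (2 * (L + 1)), div_pos (by linarith) (by positivity), ?_⟩
    have : (1 + (R - L) / (2 * (L + 1))) * L = L + (R - L) * (L / (2 * (L + 1))) := by ring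
    rw [this]
    have h1 : L / (2 * (L + 1)) < 1 := by rw [div_lt_one (by positivity)]; linarith
    nlinarith
  have hε : 0 < τ ^ 2 / 2 := by positivity
  -- No control of the means is needed: all ridge deviations vanish in the limit, whatever the
  -- posterior weights are.
  obtain ⟨CB, ρ, hCB, hρ0, hρ1, hgood⟩ := exists_good_event (J := Empty) hμs τ
    (fun β => β.elim) hε one_pos
  obtain ⟨K, hK, hpow⟩ := exists_pow_le_exp_neg_sqrt hρ0 hρ1
  obtain ⟨M4, hM4⟩ : ∃ M4, M4 = ∫ y, ‖y‖ ^ 4 ∂(isoGaussian μs τ) := ⟨_, rfl⟩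
  set δ := σw ^ 2 / σy ^ 2 with hδ
  have hδpos : 0 < δ := by positivity
  set r : ℕ → ℝ := fun k => 2 / (1 + δ * (k * (τ ^ 2 - τ ^ 2 / 2))) with hr
  have hbound : ∀ k : ℕ, iclRisk F μs ws τ (wc α) k ≤ ENNReal.ofReal
      ((1 + η) * L + (1 + η⁻¹) * r k ^ 2 * (1 + d * τ ^ 2) +
        8 * (CB * K + M4) * Real.exp (-√k / 8)) := by
    intro k
    obtain ⟨B, hB, hPB, hx⟩ := hgood k
    have hgoodx : ∀ x ∉ B, promptError F ws (wc α) x ^ 2 ≤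
        (1 + η) * inner ℝ (wc α - ws) (x (Fin.last k)) ^ 2 +
          (1 + η⁻¹) * r k ^ 2 * ‖x (Fin.last k)‖ ^ 2 := fun x hxB =>
      hF.promptError_sq_le_of_lower_bound hp hp1 hsum hwc hσμ hσw hσx hσy hws α x
        (mul_nonneg (Nat.cast_nonneg k) (by linarith)) (hx x hxB).1 hη
    have i1 : Integrable (fun y => (1 + η) * inner ℝ (wc α - ws) y ^ 2) (isoGaussian μs τ) :=
      (memLp_inner_isoGaussian μs (wc α - ws) τ).integrable_sq.const_mul _
    have i2 : Integrable (fun y => (1 + η⁻¹) * r k ^ 2 * ‖y‖ ^ 2) (isoGaussian μs τ) :=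
      (integrable_norm_pow_isoGaussian μs τ 2).const_mul _
    have hrisk := lintegral_ofReal_le_of_event (g := fun x => promptError F ws (wc α) x ^ 2)
      (h := fun y => (1 + η) * inner ℝ (wc α - ws) y ^ 2 + (1 + η⁻¹) * r k ^ 2 * ‖y‖ ^ 2)
      (fun y => by positivity) (i1.add i2) (integrable_norm_pow_isoGaussian μs τ 4) hB hgoodx
      (hF.promptError_sq_le hp hp1 hsum hwc hσμ hσw hσx hσy hws α) (Real.exp_pos (√k / 8))
    refine hrisk.trans (ENNReal.ofReal_le_ofReal ?_)
    rw [integral_add i1 i2, integral_const_mul, integral_const_mul, integral_norm_sq_isoGaussian,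
      hμs, one_pow, ← hM4]
    have e0 : (1 + η) * ∫ y, inner ℝ (wc α - ws) y ^ 2 ∂(isoGaussian μs τ) ≤ (1 + η) * L :=
      mul_le_mul_of_nonneg_left (integral_inner_sq_le hμs τ _) (by positivity)
    have e2 : Real.exp (√k / 8) * (Measure.pi fun _ : Fin (k + 1) => isoGaussian μs τ).real B ≤
        CB * (K * Real.exp (-√k / 8)) := by
      calc _ ≤ Real.exp (√k / 8) * (CB * ρ ^ k) := by gcongr
        _ = CB * (Real.exp (√k / 8) * ρ ^ k) := by ring
        _ ≤ _ := mul_le_mul_of_nonneg_left (exp_sqrt_mul_le (hpow k)) hCB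
    have e3 : M4 / Real.exp (√k / 8) = M4 * Real.exp (-√k / 8) := by
      rw [div_eq_mul_inv, ← Real.exp_neg, neg_div]
    rw [e3]
    linarith
  have hrlim : Tendsto r atTop (nhds 0) := by
    refine Tendsto.const_div_atTop ?_ 2
    refine tendsto_atTop_add_const_left _ _ (Tendsto.const_mul_atTop hδpos ?_)
    exact tendsto_natCast_atTop_atTop.atTop_mul_const (by linarith)
  have hexplim : Tendsto (fun k : ℕ => Real.exp (-√k / 8)) atTop (nhds 0) := by
    refine Real.tendsto_exp_atBot.comp ?_
    refine Tendsto.atBot_div_const (by norm_num) ?_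
    exact tendsto_neg_atTop_atBot.comp (Real.tendsto_sqrt_atTop.comp tendsto_natCast_atTop_atTop)
  have hlim : Tendsto (fun k : ℕ => (1 + η) * L + (1 + η⁻¹) * r k ^ 2 * (1 + d * τ ^ 2) +
      8 * (CB * K + M4) * Real.exp (-√k / 8)) atTop (nhds ((1 + η) * L)) := by
    have h1 := (((hrlim.pow 2).const_mul (1 + η⁻¹)).mul_const (1 + d * τ ^ 2)).const_add ((1 + η) * L)
    have h2 := h1.add (hexplim.const_mul (8 * (CB * K + M4)))
    simpa using h2
  filter_upwards [hlim.eventually_lt_const hηR] with k hk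
  exact (hbound k).trans_lt ((ENNReal.ofReal_lt_ofReal_iff (by linarith)).2 hk)

end RiskBounds

/-! ### Comparison of the rising and the decaying terms. -/

section DominantTerms

variable {d : ℕ}

lemma monotone_risingTerm (e : Vec d) (τ δw : ℝ) : Monotone (risingTerm e τ δw) := by
  intro k l hkl
  unfold risingTerm
  gcongr

lemma decayingTerms_eq (C₃ C₄ dμ uw σx σy τ : ℝ) (k : ℕ) :
    decayingTerms C₃ C₄ dμ uw σx σy τ k =
      C₃ * Real.exp (-(k * (dμ ^ 2 / (8 * σx ^ 2) + uw ^ 2 * τ ^ 2 / (8 * σy ^ 2)))) +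
        C₄ * Real.exp (-√k / 8) := by
  rw [decayingTerms, Real.sqrt_eq_rpow, neg_mul]

lemma tendsto_decayingTerms (C₃ C₄ : ℝ) {dμ σx : ℝ} (hdμ : 0 < dμ) (hσx : 0 < σx)
    (uw σy τ : ℝ) : Tendsto (decayingTerms C₃ C₄ dμ uw σx σy τ) atTop (nhds 0) := by
  simp_rw [funext (decayingTerms_eq C₃ C₄ dμ uw σx σy τ)]
  have hc : 0 < dμ ^ 2 / (8 * σx ^ 2) + uw ^ 2 * τ ^ 2 / (8 * σy ^ 2) := by positivity
  have h1 : Tendsto (fun k : ℕ =>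
      Real.exp (-(k * (dμ ^ 2 / (8 * σx ^ 2) + uw ^ 2 * τ ^ 2 / (8 * σy ^ 2))))) atTop (nhds 0) :=
    Real.tendsto_exp_neg_atTop_nhds_zero.comp
      (tendsto_natCast_atTop_atTop.atTop_mul_const hc)
  have h2 : Tendsto (fun k : ℕ => Real.exp (-√k / 8)) atTop (nhds 0) := by
    refine Real.tendsto_exp_atBot.comp (Tendsto.atBot_div_const (by norm_num) ?_)
    exact tendsto_neg_atTop_atBot.comp (Real.tendsto_sqrt_atTop.comp tendsto_natCast_atTop_atTop)
  simpa using (h1.const_mul C₃).add (h2.const_mul C₄)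

lemma eventually_decayingTerms_lt_risingTerm (C₃ C₄ : ℝ) {dμ σx : ℝ} (hdμ : 0 < dμ) (hσx : 0 < σx)
    (uw σy : ℝ) {τ δw : ℝ} (hδw : 0 < δw) {e : Vec d} (he : e ≠ 0) :
    ∀ᶠ k : ℕ in atTop, decayingTerms C₃ C₄ dμ uw σx σy τ k < risingTerm e τ δw k := by
  have he' : 0 < ‖e‖ := norm_pos_iff.2 he
  -- By monotonicity the value at `1` is a positive lower bound for all later terms; the value at
  -- `0` is zero.
  have hpos : 0 < risingTerm e τ δw 1 := by unfold risingTerm; positivity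
  filter_upwards [(tendsto_decayingTerms C₃ C₄ hdμ hσx uw σy τ).eventually_lt_const hpos,
    eventually_ge_atTop 1] with k hk hk1
  exact hk.trans_le (monotone_risingTerm e τ δw hk1)

lemma exists_risingTerm_lt_decayingTerms {C₃ C₄ : ℝ} (hC₃ : 0 < C₃) (hC₄ : 0 < C₄)
    (dμ uw σx σy : ℝ) {τ : ℝ} (hτ : 0 < τ) (e : Vec d) (N : ℕ) :
    ∃ ε : ℝ, 0 < ε ∧ ∀ δμ δw : ℝ, 0 < δμ → 0 < δw → δμ < ε → δw < ε → ∀ k : ℕ, k ≤ N →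
      (k : ℝ) ≤ min (1 / δμ - 1) (1 / (δw * τ ^ 2)) ∧
        risingTerm e τ δw k < decayingTerms C₃ C₄ dμ uw σx σy τ k := by
  set A := C₄ * Real.exp (-√N / 8) with hA
  have hApos : 0 < A := by positivity
  set D := ‖e‖ ^ 2 * (1 + d * τ ^ 2) * (4 * (N : ℝ) ^ 2 * (1 + τ ^ 2) ^ 2) with hD
  have hD0 : 0 ≤ D := by positivity
  -- The first two entries put `N` inside the interval, `1` allows `δw² ≤ δw`, and `A / (D + 1)`
  -- yields `D δw < A`, where `A` bounds the decaying terms from below on `k ≤ N`.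
  refine ⟨min (1 / (N + 1)) (min (1 / ((N + 1) * τ ^ 2)) (min 1 (A / (D + 1)))), by positivity,
    fun δμ δw hδμ hδw hμ hw k hk => ?_⟩
  simp only [lt_min_iff] at hμ hw
  have hkN : (k : ℝ) ≤ N := by exact_mod_cast hk
  refine ⟨le_min ?_ ?_, ?_⟩
  · have h1 := (lt_one_div hδμ (by positivity)).1 hμ.1
    linarith
  · rw [le_div_iff₀ (by positivity)]
    have h1 := hw.2.1
    rw [lt_div_iff₀ (by positivity)] at h1
    have h2 : (k : ℝ) * (δw * τ ^ 2) ≤ (N + 1) * (δw * τ ^ 2) := by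
      gcongr; linarith
    linarith
  · have h1 : risingTerm e τ δw k ≤ D * δw := by
      calc risingTerm e τ δw k
          ≤ ‖e‖ ^ 2 * (1 + d * τ ^ 2) * (4 * (k : ℝ) ^ 2 * δw ^ 2 * (1 + τ ^ 2) ^ 2) :=
            mul_le_mul_of_nonneg_left (min_le_right _ _) (by positivity)
        _ ≤ ‖e‖ ^ 2 * (1 + d * τ ^ 2) * (4 * (N : ℝ) ^ 2 * δw * (1 + τ ^ 2) ^ 2) := by
            gcongr
            nlinarith [hw.2.2.1]
        _ = D * δw := by rw [hD]; ring
    have h2 : D * δw < A := by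
      have h3 := hw.2.2.2
      rw [lt_div_iff₀ (by positivity)] at h3
      nlinarith
    have h4 : A ≤ decayingTerms C₃ C₄ dμ uw σx σy τ k := by
      rw [decayingTerms_eq, hA]
      have h5 : 0 ≤ C₃ * Real.exp
        (-(k * (dμ ^ 2 / (8 * σx ^ 2) + uw ^ 2 * τ ^ 2 / (8 * σy ^ 2)))) := by positivity
      have h6 : Real.exp (-√N / 8) ≤ Real.exp (-√k / 8) := by gcongr
      nlinarith
    linarith

end DominantTerms

end ICL

end

/-! ### Assembly of the claims. -/

theorem theorem3 {d M : ℕ}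
    -- mixture weights and centers of the task prior, sample noise scales
    (p : Fin M → ℝ) (μc wc : Fin M → ICL.Vec d) (σx σy : ℝ)
    (hp_pos : ∀ m, 0 < p m) (hp_lt : ∀ m, p m < 1) (hp_sum : ∑ m, p m = 1)
    (hμc : ∀ m, ‖μc m‖ = 1) (hwc : ∀ m, ‖wc m‖ = 1)
    (hσx : 0 < σx) (hσy : 0 < σy)
    -- in-context task
    (μs ws : ICL.Vec d) (τ : ℝ) (hτ : 0 < τ) (hμs : ‖μs‖ = 1) (hws : ‖ws‖ = 1)
    -- biased labels and margins
    (α : Fin M) (hbias : ws ≠ wc α)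
    (dμ dw uw : ℝ) (hdμ : 0 < dμ) (hdw : 0 < dw) (huw : 0 < uw)
    (hmarginμ : ∀ β, β ≠ α → dμ ^ 2 ≤ ‖μc β - μs‖ ^ 2 - ‖μc α - μs‖ ^ 2)
    (hmarginw : ∀ β, β ≠ α → dw ^ 2 ≤ ‖wc β - ws‖ ^ 2 - ‖wc α - ws‖ ^ 2)
    (hmarginu : ∀ β, β ≠ α →
      τ ^ 2 * uw ^ 2 ≤ τ ^ 2 * ‖wc β - ws‖ ^ 2 - (1 + τ ^ 2) * ‖wc α - ws‖ ^ 2) :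
    -- the constants depend neither on the task noises `σμ, σw` nor on `δ`, `k`
    ∃ C₁ C₂ C₃ C₄ : ℝ, 0 < C₁ ∧ 0 < C₂ ∧ 0 < C₃ ∧ 0 < C₄ ∧
      -- asymptotic bound
      (∀ σμ σw : ℝ, 0 < σμ → 0 < σw →
        ∀ F : ICL.Predictor d, ICL.IsOptimalPredictor (ICL.taskPrior p μc wc σμ σw) σx σy F →
        ∀ δ : ℝ, 0 < δ → δ < 1 / 2 →
        ∃ g : ℕ → ℝ, g =O[atTop] (fun k : ℕ => (k : ℝ) ^ (-2 : ℤ)) ∧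
          ∀ᶠ k : ℕ in atTop,
            ICL.iclRisk F μs ws τ (wc α) k <
              ENNReal.ofReal (‖wc α - ws‖ ^ 2 * (1 + d * τ ^ 2) +
                C₁ / (k * (σw ^ 2 / σy ^ 2)) * Real.exp (C₂ * (k : ℝ) ^ (δ / 2 - 3 / 4)) +
                g k)) ∧
      -- bound on the interval `k ≤ min {1 / δμ - 1, 1 / (δw τ²)}`
      (∀ σμ σw : ℝ, 0 < σμ → 0 < σw →
        ∀ F : ICL.Predictor d, ICL.IsOptimalPredictor (ICL.taskPrior p μc wc σμ σw) σx σy F →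
        ∀ k : ℕ,
          (k : ℝ) ≤ min (1 / (σμ ^ 2 / σx ^ 2) - 1) (1 / (σw ^ 2 / σy ^ 2 * τ ^ 2)) →
            ICL.iclRisk F μs ws τ (wc α) k <
              ENNReal.ofReal (ICL.risingTerm (wc α - ws) τ (σw ^ 2 / σy ^ 2) k +
                ICL.decayingTerms C₃ C₄ dμ uw σx σy τ k)) ∧
      -- for small `δμ` and `δw`, the interval contains any prescribed initial segment, on which
      -- the decaying terms dominate the bound
      (∀ N : ℕ, ∃ ε : ℝ, 0 < ε ∧ ∀ σμ σw : ℝ, 0 < σμ → 0 < σw →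
        σμ ^ 2 / σx ^ 2 < ε → σw ^ 2 / σy ^ 2 < ε →
        ∀ k : ℕ, k ≤ N →
          (k : ℝ) ≤ min (1 / (σμ ^ 2 / σx ^ 2) - 1) (1 / (σw ^ 2 / σy ^ 2 * τ ^ 2)) ∧
          ICL.risingTerm (wc α - ws) τ (σw ^ 2 / σy ^ 2) k <
            ICL.decayingTerms C₃ C₄ dμ uw σx σy τ k) ∧
      -- for large `k` the non-decreasing term dominates the bound
      (∀ σw : ℝ, 0 < σw → Monotone (ICL.risingTerm (wc α - ws) τ (σw ^ 2 / σy ^ 2)) ∧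
        ∀ᶠ k : ℕ in atTop,
          ICL.decayingTerms C₃ C₄ dμ uw σx σy τ k <
            ICL.risingTerm (wc α - ws) τ (σw ^ 2 / σy ^ 2) k) := by
  obtain ⟨β, hβ⟩ := ICL.exists_ne_of_weight_lt_one hp_lt hp_sum α
  have he : 0 < ‖wc α - ws‖ := norm_pos_iff.2 (sub_ne_zero.2 hbias.symm)
  have hd : 2 ≤ d := by
    refine ICL.two_le_dim hws (hwc α) (hwc β) hbias (lt_of_pow_lt_pow_left₀ 2 (norm_nonneg _) ?_)
    have := hmarginw β hβ
    have : 0 < dw ^ 2 := by positivity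
    linarith
  obtain ⟨C, hC, hshort⟩ := ICL.exists_iclRisk_le_short hp_pos hp_lt hp_sum hwc hσx hσy hτ hμs hws α
    hdμ huw hmarginμ hmarginu
  -- The terms with `C₁`, `C₂` and `C₃` only need to be nonnegative, since `C` already accounts for
  -- all decaying errors; `C + 1` makes the last constant positive.
  refine ⟨1, 1, 1, C + 1, one_pos, one_pos, one_pos, by positivity, ?_, ?_, ?_, ?_⟩
  · intro σμ σw hσμ hσw F hF δ _ _
    -- Zero remainder suffices: as `d ≥ 2`, the asymptotic risk stays below the main term by a fixed
    -- gap.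
    refine ⟨fun _ => 0, isBigO_zero _ _, ?_⟩
    have hlt : (1 + τ ^ 2) * ‖wc α - ws‖ ^ 2 < ‖wc α - ws‖ ^ 2 * (1 + d * τ ^ 2) := by
      have h2 : (2 : ℝ) ≤ d := by exact_mod_cast hd
      have h3 : 0 < ‖wc α - ws‖ ^ 2 * τ ^ 2 := by positivity
      nlinarith
    filter_upwards [ICL.eventually_iclRisk_lt hp_pos hp_lt hp_sum hwc hσμ hσw hσx hσy hF hτ hμs hws
      α hlt] with k hk
    refine hk.trans_le (ENNReal.ofReal_le_ofReal ?_)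
    have : 0 ≤ 1 / (k * (σw ^ 2 / σy ^ 2)) * Real.exp (1 * (k : ℝ) ^ (δ / 2 - 3 / 4)) := by
      positivity
    linarith
  · intro σμ σw hσμ hσw F hF k hk
    have hδμ : 0 < σμ ^ 2 / σx ^ 2 := by positivity
    -- The `- 1` in the endpoint `1 / δμ - 1` accounts for the query among the `k + 1` inputs.
    have hk' : ((k + 1 : ℕ) : ℝ) * (σμ ^ 2 / σx ^ 2) ≤ 1 := by
      rw [← le_div_iff₀ hδμ]
      push_cast
      linarith [hk.trans (min_le_left _ _)]
    refine (hshort σμ σw hσμ hσw F hF k hk').trans_lt ?_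
    have hrise : 0 ≤ ICL.risingTerm (wc α - ws) τ (σw ^ 2 / σy ^ 2) k := by
      unfold ICL.risingTerm; positivity
    have hdecay : C * Real.exp (-√k / 8) < ICL.decayingTerms 1 (C + 1) dμ uw σx σy τ k := by
      rw [ICL.decayingTerms_eq]
      have h1 : 0 < 1 * Real.exp
        (-(k * (dμ ^ 2 / (8 * σx ^ 2) + uw ^ 2 * τ ^ 2 / (8 * σy ^ 2)))) := by positivity
      linarith [Real.exp_pos (-√k / 8)]
    have hCk : 0 ≤ C * Real.exp (-√k / 8) := by positivity
    exact (ENNReal.ofReal_lt_ofReal_iff (by linarith)).2 (by linarith)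
  · intro N
    obtain ⟨ε, hε, h⟩ := ICL.exists_risingTerm_lt_decayingTerms one_pos (by positivity : 0 < C + 1)
      dμ uw σx σy hτ (wc α - ws) N
    exact ⟨ε, hε, fun σμ σw hσμ hσw => h _ _ (by positivity) (by positivity)⟩
  · intro σw hσw
    exact ⟨ICL.monotone_risingTerm _ _ _, ICL.eventually_decayingTerms_lt_risingTerm _ _ hdμ hσx uw
      σy (by positivity) (sub_ne_zero.2 hbias.symm)⟩
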